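/- For $n\ge 1$ let $G_n$ be the graph with vertex set $\{0,1/n,2/n,\dots,1\}$ and edges $\{(j-1)/n,\,j/n\}$, $j=1,\dots,n$, and write $S^n_j$ for the spin at the vertex $j/n$, a unit vector in $\mathbb{R}^2=\mathbb{C}$. Consider the XY model on $G_n$ with free boundary conditions at inverse temperature $\mathcal{B}_n\in\mathbb{R}$, that is, let $(S^n_0,\dots,S^n_n)$ be distributed according to the Gibbs measure $$Z_n^{-1}\exp\Big(\mathcal{B}_n\sum_{j=1}^n S^n_{j-1}\cdot S^n_j\Big)\prod_{j=0}^n dS^n_j ,$$ where $dS$ is arc length on the unit circle $\mathbb{S}^1$ and $Z_n$ is the normalizing constant. Suppose that $\mathcal{B}_n/n\to b\in(0,\infty)$ as $n\to\infty$. Then the random càdlàg paths $\big(S^n_{\lfloor nt\rfloor}\big)_{t\in[0,1]}$ converge in distribution, in the space $D([0,1],\mathbb{S}^1)$ with the Skorohod ($J_1$) metric, to $S(t)=(\cos\Phi(t),\sin\Phi(t))=e^{i\Phi(t)}$, $t\in[0,1]$, where $S$ has càdlàg paths, $\Phi(0)$ is uniformly distributed on $[-\pi,\pi)$, the process $\big(e^{i(\Phi(t)-\Phi(0))}\big)_{t\in[0,1]}$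 is independent of $\Phi(0)$, and this process has the same distribution as $\big(e^{iB(t)/\sqrt b}\big)_{t\in[0,1]}$ for a standard one-dimensional Brownian motion $B$. -/

import Mathlib

open MeasureTheory ProbabilityTheory Filter Set
open scoped Topology ENNReal unitInterval

noncomputable section

/-- A càdlàg path on `[0,1]` with values in `E`: right-continuous with left limits. -/
structure CadlagPath (E : Type*) [TopologicalSpace E] where
  /-- the underlying function -/
  toFun : I → E
  right_continuous : ∀ t : I, ContinuousWithinAt toFun (Ici t) t
  left_limit : ∀ t : I, ∃ l : E, Tendsto toFun (𝓝[<] t) (𝓝 l)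

namespace CadlagPath

instance {E : Type*} [TopologicalSpace E] : CoeFun (CadlagPath E) (fun _ => I → E) :=
  ⟨CadlagPath.toFun⟩

/-- The Skorohod (`J₁`) distance
`d(x, y) = inf_φ max (sup_t |φ(t) - t|, sup_t d(x(t), y(φ(t))))`,
where `φ` runs over the increasing bijections of `[0,1]`. -/
def skorohodEDist {E : Type*} [PseudoEMetricSpace E] (x y : CadlagPath E) : ℝ≥0∞ :=
  ⨅ φ : I ≃o I, max (⨆ t : I, edist (φ t) t) (⨆ t : I, edist (x t) (y (φ t)))

theorem skorohodEDist_comm_le {E : Type*} [PseudoEMetricSpace E] (x y : CadlagPath E) :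
    skorohodEDist y x ≤ skorohodEDist x y := by
  refine le_iInf fun φ => (iInf_le _ φ.symm).trans (max_le_max ?_ ?_)
  · refine iSup_le fun t => ?_
    have := le_iSup (fun t : I => edist (φ t) t) (φ.symm t)
    simpa [edist_comm] using this
  · refine iSup_le fun t => ?_
    have := le_iSup (fun t : I => edist (x t) (y (φ t))) (φ.symm t)
    simpa [edist_comm] using this

theorem skorohodEDist_triangle {E : Type*} [PseudoEMetricSpace E] (x y z : CadlagPath E) :
    skorohodEDist x z ≤ skorohodEDist x y + skorohodEDist y z := by
  refine ENNReal.le_iInf_add_iInf fun φ ψ => (iInf_le _ (φ.trans ψ)).trans (max_le ?_ ?_)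
  · refine iSup_le fun t => ?_
    calc edist (ψ (φ t)) t ≤ edist (φ t) t + edist (ψ (φ t)) (φ t) := by
          rw [add_comm]; exact edist_triangle _ _ _
      _ ≤ _ := add_le_add
          ((le_iSup (fun t : I => edist (φ t) t) t).trans (le_max_left _ _))
          ((le_iSup (fun t : I => edist (ψ t) t) (φ t)).trans (le_max_left _ _))
  · refine iSup_le fun t => ?_
    calc edist (x t) (z (ψ (φ t))) ≤ edist (x t) (y (φ t)) + edist (y (φ t)) (z (ψ (φ t))) :=
          edist_triangle _ _ _
      _ ≤ _ := add_le_add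
          ((le_iSup (fun t : I => edist (x t) (y (φ t))) t).trans (le_max_right _ _))
          ((le_iSup (fun t : I => edist (y t) (z (ψ t))) (φ t)).trans (le_max_right _ _))

/-- The Skorohod space `D([0,1], E)` carries the Skorohod distance and its topology. -/
instance {E : Type*} [PseudoEMetricSpace E] : PseudoEMetricSpace (CadlagPath E) where
  edist := skorohodEDist
  edist_self x := by
    refine le_antisymm ((iInf_le _ (OrderIso.refl I)).trans ?_) zero_le
    simp
  edist_comm x y := le_antisymm (skorohodEDist_comm_le y x) (skorohodEDist_comm_le x y)
  edist_triangle := skorohodEDist_triangle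

instance {E : Type*} [PseudoEMetricSpace E] : MeasurableSpace (CadlagPath E) :=
  borel (CadlagPath E)

instance {E : Type*} [PseudoEMetricSpace E] : BorelSpace (CadlagPath E) := ⟨rfl⟩

end CadlagPath

/-- The unit circle carries its Borel σ-algebra. -/
instance : MeasurableSpace Circle := borel Circle

instance : BorelSpace Circle := ⟨rfl⟩

namespace XYChain

/-- The vertex `⌊n t⌋` of the chain `0, 1, …, n` (vertex `j` sits at the point `j / n`). -/
def site (n : ℕ) (t : I) : Fin (n + 1) :=
  ⟨⌊(n : ℝ) * (t : ℝ)⌋₊, Nat.lt_succ_of_le (Nat.floor_le_of_le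
    (mul_le_of_le_one_right n.cast_nonneg t.2.2))⟩

theorem site_eventually_right (n : ℕ) (t : I) : ∀ᶠ s in 𝓝[≥] t, site n s = site n t := by
  have hc : Continuous fun s : I => (n : ℝ) * (s : ℝ) := by fun_prop
  have h1 : ∀ᶠ s : I in 𝓝[≥] t, (n : ℝ) * (s : ℝ) < ⌊(n : ℝ) * (t : ℝ)⌋₊ + 1 :=
    (hc.continuousAt.eventually_lt continuousAt_const (Nat.lt_floor_add_one _)).filter_mono
      nhdsWithin_le_nhds
  filter_upwards [h1, self_mem_nhdsWithin] with s hs hts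
  refine Fin.ext ((Nat.floor_eq_iff (mul_nonneg n.cast_nonneg s.2.1)).2 ⟨?_, hs⟩)
  exact (Nat.floor_le (mul_nonneg n.cast_nonneg t.2.1)).trans
    (mul_le_mul_of_nonneg_left hts n.cast_nonneg)

theorem site_eventually_left (n : ℕ) (t : I) :
    ∃ j : Fin (n + 1), ∀ᶠ s in 𝓝[<] t, site n s = j := by
  have hc : Continuous fun s : I => (n : ℝ) * (s : ℝ) := by fun_prop
  by_cases h : 0 < (n : ℝ) * (t : ℝ)
  · have hn : (0 : ℝ) < n := by
      by_contra h0
      have : (n : ℝ) = 0 := le_antisymm (not_lt.1 h0) n.cast_nonneg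
      simp [this] at h
    have hceil : 1 ≤ ⌈(n : ℝ) * (t : ℝ)⌉₊ := Nat.ceil_pos.2 h
    have hle : ⌈(n : ℝ) * (t : ℝ)⌉₊ ≤ n :=
      Nat.ceil_le.2 (mul_le_of_le_one_right n.cast_nonneg t.2.2)
    have hlt : ((⌈(n : ℝ) * (t : ℝ)⌉₊ - 1 : ℕ) : ℝ) < (n : ℝ) * (t : ℝ) :=
      Nat.lt_ceil.1 (by omega)
    refine ⟨⟨⌈(n : ℝ) * (t : ℝ)⌉₊ - 1, by omega⟩, ?_⟩
    have h1 : ∀ᶠ s : I in 𝓝[<] t, ((⌈(n : ℝ) * (t : ℝ)⌉₊ - 1 : ℕ) : ℝ) < (n : ℝ) * (s : ℝ) :=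
      (continuousAt_const.eventually_lt hc.continuousAt hlt).filter_mono nhdsWithin_le_nhds
    filter_upwards [h1, self_mem_nhdsWithin] with s hs hst
    refine Fin.ext ((Nat.floor_eq_iff (mul_nonneg n.cast_nonneg s.2.1)).2 ⟨hs.le, ?_⟩)
    have h2 : (n : ℝ) * (s : ℝ) < (n : ℝ) * (t : ℝ) := mul_lt_mul_of_pos_left hst hn
    have h3 : ((⌈(n : ℝ) * (t : ℝ)⌉₊ - 1 : ℕ) : ℝ) + 1 = ⌈(n : ℝ) * (t : ℝ)⌉₊ := by
      exact_mod_cast Nat.sub_add_cancel hceil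
    rw [h3]
    exact h2.trans_le (Nat.le_ceil _)
  · refine ⟨0, ?_⟩
    filter_upwards [self_mem_nhdsWithin] with s hs
    have hst : (n : ℝ) * (s : ℝ) ≤ 0 :=
      (mul_le_mul_of_nonneg_left (le_of_lt hs) n.cast_nonneg).trans (not_lt.1 h)
    exact Fin.ext (Nat.floor_of_nonpos hst)

/-- The path `t ↦ S_{⌊n t⌋}`, `t ∈ [0,1]`, of a spin configuration `S` on the chain. -/
def spinPath (n : ℕ) (S : Fin (n + 1) → Circle) : CadlagPath Circle where
  toFun t := S (site n t)
  right_continuous t :=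
    tendsto_nhds_of_eventually_eq ((site_eventually_right n t).mono fun _ h => by rw [h])
  left_limit t := by
    obtain ⟨j, hj⟩ := site_eventually_left n t
    exact ⟨S j, tendsto_nhds_of_eventually_eq (hj.mono fun _ h => by rw [h])⟩

/-- Arc length on the unit circle: the image of Lebesgue measure on `(-π, π]` under `θ ↦ e^{iθ}`. -/
def arcLength : Measure Circle :=
  (volume.restrict (Ioc (-Real.pi) Real.pi)).map Circle.exp

/-- The Hamiltonian of the chain with free boundary conditions,
`H(S) = - ∑_{j=1}^{n} S_{j-1} · S_j`, where `·` is the inner product of `ℝ² = ℂ`. -/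
def hamiltonian (n : ℕ) (S : Fin (n + 1) → Circle) : ℝ :=
  -∑ j : Fin n, inner ℝ (S j.castSucc : ℂ) (S j.succ : ℂ)

/-- The Gibbs measure `Z⁻¹ exp(-β H(S)) ∏_j dS_j` at inverse temperature `β`. -/
def gibbs (n : ℕ) (β : ℝ) : Measure (Fin (n + 1) → Circle) :=
  (Measure.pi fun _ => arcLength).tilted fun S => -β * hamiltonian n S

instance : IsFiniteMeasure arcLength := by
  unfold arcLength; infer_instance

instance : NeZero arcLength := by
  refine ⟨fun h => ?_⟩
  have h1 : arcLength univ = 0 := by simp [h]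
  rw [arcLength, Measure.map_apply Circle.exp.continuous.measurable MeasurableSet.univ] at h1
  simp [Real.pi_pos.not_ge] at h1

instance (n : ℕ) (β : ℝ) : IsProbabilityMeasure (gibbs n β) := by
  have hc : Continuous fun S : Fin (n + 1) → Circle => Real.exp (-β * hamiltonian n S) := by
    unfold hamiltonian; fun_prop
  have : NeZero (Measure.pi fun _ : Fin (n + 1) => arcLength) := by
    refine ⟨fun h => ?_⟩
    have h1 : (Measure.pi fun _ : Fin (n + 1) => arcLength) univ = 0 := by simp [h]
    rw [Measure.pi_univ, Finset.prod_eq_zero_iff] at h1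
    obtain ⟨_, _, h2⟩ := h1
    exact NeZero.ne arcLength (Measure.measure_univ_eq_zero.1 h2)
  exact isProbabilityMeasure_tilted (hc.integrable_of_hasCompactSupport
    (HasCompactSupport.of_compactSpace _))

end XYChain

end

/-!
Writing the spins as `S_j = ξ_0 ξ_1 ⋯ ξ_j` turns the Gibbs measure of the chain into the law of a
random walk on the circle with a uniform start and independent von Mises steps. As the parameter
`β_n ∼ b n` grows, Laplace's method gives `β (1 - 𝔼 ξ ^ k) → k ^ 2 / 2` for the Fourier
coefficients of a step, so `𝔼 ξ ^ k` raised to the power `τ n` tends to `exp (-k ^ 2 τ / (2 b))`,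
the coefficient of `exp (i B(τ) / √b)`. Since characters determine weak convergence on the torus,
the finite-dimensional distributions converge. The same coefficients bound the second and fourth
moments of the displacement over a block of steps, and Ottaviani's inequality upgrades these bounds
to the maximal displacement. Hence the path is, for all large `n`, close in probability to its step
function over a coarse grid, and coarse step functions of the limit converge to it because the limit
has continuous paths.
-/

noncomputable section

section Tilted

theorem pi_tilted_sum {ι : Type*} [Fintype ι] {α : ι → Type*} [∀ i, MeasurableSpace (α i)]
    (μ : ∀ i, Measure (α i)) [∀ i, IsFiniteMeasure (μ i)] (f : ∀ i, α i → ℝ) :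
    (Measure.pi μ).tilted (fun x => ∑ i, f i (x i)) = Measure.pi fun i => (μ i).tilted (f i) := by
  refine (Measure.pi_eq fun s hs => ?_).symm
  simp_rw [tilted_apply_eq_ofReal_integral' _ (MeasurableSet.univ_pi hs),
    fun i => tilted_apply_eq_ofReal_integral' (μ := μ i) (f i) (hs i), Real.exp_sum]
  rw [← ENNReal.ofReal_prod_of_nonneg fun i _ => integral_nonneg fun x => by positivity,
    Measure.restrict_pi_pi, integral_fintype_prod_eq_prod (fun i x => Real.exp (f i x))]
  simp_rw [← Finset.prod_div_distrib]
  rw [integral_fintype_prod_eq_prod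
    (fun i x => Real.exp (f i x) / ∫ y, Real.exp (f i y) ∂(μ i))]

theorem tilted_map {α γ : Type*} [MeasurableSpace α] [MeasurableSpace γ] {μ : Measure α}
    {T : α → γ} (hT : Measurable T) {f : γ → ℝ} (hf : Measurable f) :
    (μ.map T).tilted f = (μ.tilted (f ∘ T)).map T := by
  ext s hs
  rw [Measure.map_apply hT hs, tilted_apply' _ _ hs, tilted_apply' _ _ (hT hs),
    integral_map hT.aemeasurable (by fun_prop), setLIntegral_map hs (by fun_prop) hT]
  rfl

end Tilted

section ConvergenceInDistribution

theorem abs_integral_le_add_mul_measureReal {Ω : Type*} [MeasurableSpace Ω] {μ : Measure Ω}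
    [IsProbabilityMeasure μ] {h : Ω → ℝ} {A : Set Ω} {a C : ℝ} (ha : 0 ≤ a)
    (hA : ∀ x ∉ A, |h x| ≤ a) (hC : ∀ x, |h x| ≤ C) : |∫ x, h x ∂μ| ≤ a + C * μ.real A := by
  have hint : Integrable ((toMeasurable μ A).indicator fun _ => C) μ :=
    (integrable_const C).indicator (measurableSet_toMeasurable μ A)
  calc |∫ x, h x ∂μ| ≤ ∫ x, (a + (toMeasurable μ A).indicator (fun _ => C) x) ∂μ := by
        refine (Real.norm_eq_abs _).symm.le.trans (norm_integral_le_of_norm_le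
          ((integrable_const a).add hint) (Eventually.of_forall fun x => ?_))
        rw [Real.norm_eq_abs]
        by_cases hx : x ∈ toMeasurable μ A
        · rw [indicator_of_mem hx]
          linarith [hC x]
        · rw [indicator_of_notMem hx, add_zero]
          exact hA x fun h => hx (subset_toMeasurable μ A h)
    _ = a + C * μ.real A := by
        rw [integral_add (integrable_const a) hint,
          integral_indicator_const C (measurableSet_toMeasurable μ A)]
        simp [measureReal_def, measure_toMeasurable, mul_comm]

variable {E : Type*} [PseudoEMetricSpace E] [MeasurableSpace E]

theorem dist_integral_comp_le_of_lipschitzWith [OpensMeasurableSpace E] {Ω : Type*}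
    [MeasurableSpace Ω] {μ : Measure Ω} [IsProbabilityMeasure μ] {X Y : Ω → E}
    (hX : AEMeasurable X μ) (hY : AEMeasurable Y μ) {f : E → ℝ} {K : NNReal}
    (hf : LipschitzWith K f) {C : ℝ} (hC : ∀ x y, dist (f x) (f y) ≤ C) (ε : NNReal) :
    dist (∫ ω, f (X ω) ∂μ) (∫ ω, f (Y ω) ∂μ) ≤ K * ε + C * μ.real {ω | ε < edist (X ω) (Y ω)} := by
  obtain ⟨ω₀⟩ := μ.nonempty_of_neZero
  have hint : ∀ {U : Ω → E}, AEMeasurable U μ → Integrable (fun ω => f (U ω)) μ := fun {U} hU => by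
    refine Integrable.of_bound (hf.continuous.measurable.comp_aemeasurable hU).aestronglyMeasurable
      (‖f (X ω₀)‖ + C) (Eventually.of_forall fun ω => ?_)
    have h := hC (U ω) (X ω₀)
    rw [dist_eq_norm] at h
    linarith [norm_le_norm_add_norm_sub' (f (U ω)) (f (X ω₀))]
  rw [Real.dist_eq, ← integral_sub (hint hX) (hint hY)]
  refine abs_integral_le_add_mul_measureReal (by positivity) (fun ω hω => ?_) fun ω => hC _ _
  have h : edist (f (X ω)) (f (Y ω)) ≤ (K * ε : NNReal) := by
    rw [ENNReal.coe_mul]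
    exact (hf _ _).trans (by gcongr; exact not_lt.1 hω)
  exact dist_le_coe.2 (edist_le_coe.1 h)

variable {ι : Type*} {l : Filter ι} {Ω : ι → Type*} [∀ i, MeasurableSpace (Ω i)]
  {μ : ∀ i, Measure (Ω i)} [∀ i, IsProbabilityMeasure (μ i)]
  {Ω' : Type*} [MeasurableSpace Ω'] {μ' : Measure Ω'} [IsProbabilityMeasure μ']

theorem tendsto_integral_comp_of_tendstoInDistribution [OpensMeasurableSpace E]
    {X : ∀ i, Ω i → E} {Z : Ω' → E} (h : TendstoInDistribution X l Z μ μ') {f : E → ℝ}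
    (hf : Continuous f) {C : ℝ} (hC : ∀ x y, dist (f x) (f y) ≤ C) :
    Tendsto (fun i => ∫ ω, f (X i ω) ∂(μ i)) l (𝓝 (∫ ω, f (Z ω) ∂μ')) := by
  have hlim := ProbabilityMeasure.tendsto_iff_forall_integral_tendsto.1 h.tendsto
    (.mkOfBound ⟨f, hf⟩ C hC)
  simp only [ProbabilityMeasure.coe_mk, BoundedContinuousFunction.mkOfBound_coe,
    ContinuousMap.coe_mk] at hlim
  rw [integral_map h.aemeasurable_limit hf.measurable.aestronglyMeasurable] at hlim
  exact hlim.congr fun i =>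
    integral_map (h.forall_aemeasurable i) hf.measurable.aestronglyMeasurable

theorem tendstoInDistribution_of_approx [OpensMeasurableSpace E] [l.IsCountablyGenerated]
    {κ : Type*} {l' : Filter κ} [l'.NeBot] {X : ∀ i, Ω i → E} {Y : κ → ∀ i, Ω i → E}
    {W : κ → Ω' → E} {Z : Ω' → E} (hX : ∀ i, AEMeasurable (X i) (μ i))
    (hYW : ∀ᶠ k in l', TendstoInDistribution (Y k) l (W k) μ μ')
    (hWZ : TendstoInDistribution W l' Z (fun _ => μ') μ')
    (hXY : ∀ ε > 0, ∀ δ > 0, ∀ᶠ k in l', ∀ᶠ i in l,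
      (μ i).real {ω | ENNReal.ofNNReal ε < edist (X i ω) (Y k i ω)} < δ) :
    TendstoInDistribution X l Z μ μ' := by
  refine ⟨hX, hWZ.aemeasurable_limit, tendsto_iff_forall_lipschitz_integral_tendsto.2 ?_⟩
  rintro f ⟨C, hC⟩ ⟨K, hK⟩
  have hf := hK.continuous
  simp only [ProbabilityMeasure.coe_mk]
  rw [integral_map hWZ.aemeasurable_limit hf.measurable.aestronglyMeasurable]
  simp_rw [fun i => integral_map (hX i) hf.measurable.aestronglyMeasurable]
  rw [Metric.tendsto_nhds]
  intro η hη
  obtain ⟨ε, hε, hKε⟩ := exists_pos_mul_lt (show 0 < η / 4 by positivity) (K : ℝ)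
  obtain ⟨δ, hδ, hCδ⟩ := exists_pos_mul_lt (show 0 < η / 4 by positivity) C
  lift ε to NNReal using hε.le
  obtain ⟨k, hXYk, hYWk, hWZk⟩ := ((hXY ε (mod_cast hε) δ hδ).and (hYW.and
    (Metric.tendsto_nhds.1 (tendsto_integral_comp_of_tendstoInDistribution hWZ hf hC) (η / 4)
      (by positivity)))).exists
  filter_upwards [hXYk, Metric.tendsto_nhds.1
    (tendsto_integral_comp_of_tendstoInDistribution hYWk hf hC) (η / 4) (by positivity)]
    with i hXYi hYWi
  obtain ⟨ω₀⟩ := (μ i).nonempty_of_neZero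
  have hC₀ : 0 ≤ C := dist_nonneg.trans (hC (X i ω₀) (X i ω₀))
  have hclose := dist_integral_comp_le_of_lipschitzWith (hX i) (hYWk.forall_aemeasurable i) hK hC ε
  have := mul_le_mul_of_nonneg_left hXYi.le hC₀
  linarith [dist_triangle4 (∫ ω, f (X i ω) ∂(μ i)) (∫ ω, f (Y k i ω) ∂(μ i))
    (∫ ω, f (W k ω) ∂μ') (∫ ω, f (Z ω) ∂μ')]

theorem tendstoInDistribution_map {E' : Type*} [TopologicalSpace E'] [MeasurableSpace E']
    [OpensMeasurableSpace E'] {F : ι → Type*} [∀ i, MeasurableSpace (F i)]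
    {T : ∀ i, Ω i → F i} (hT : ∀ i, AEMeasurable (T i) (μ i))
    [∀ i, IsProbabilityMeasure ((μ i).map (T i))] {X : ∀ i, F i → E'} (hX : ∀ i, Measurable (X i))
    {Z : Ω' → E'} (h : TendstoInDistribution (fun i => X i ∘ T i) l Z μ μ') :
    TendstoInDistribution X l Z (fun i => (μ i).map (T i)) μ' where
  forall_aemeasurable i := (hX i).aemeasurable
  aemeasurable_limit := h.aemeasurable_limit
  tendsto := by
    simpa only [fun i => AEMeasurable.map_map_of_aemeasurable (hX i).aemeasurable (hT i)]
      using h.tendsto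

end ConvergenceInDistribution

section CumProd

variable {G : Type*} [CommGroup G]

/-- The map sending `(x₀, …, xₙ₋₁)` to its partial products `(x₀, x₀x₁, …, x₀⋯xₙ₋₁)`. It is
bundled as a homomorphism so that on a compact group it can be seen to preserve Haar measure. -/
def cumProd (n : ℕ) : (Fin n → G) →* (Fin n → G) where
  toFun x j := ∏ i ∈ Finset.Iic j, x i
  map_one' := by ext; simp
  map_mul' x y := by ext1 j; simp [Finset.prod_mul_distrib]

theorem continuous_cumProd [TopologicalSpace G] [ContinuousMul G] (n : ℕ) :
    Continuous (cumProd n : (Fin n → G) →* (Fin n → G)) := by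
  change Continuous fun (x : Fin n → G) j => ∏ i ∈ Finset.Iic j, x i
  fun_prop

theorem cumProd_zero {n : ℕ} (x : Fin (n + 1) → G) : cumProd (n + 1) x 0 = x 0 := by
  have : Finset.Iic (0 : Fin (n + 1)) = {0} := by ext; simp
  simp [cumProd, this]

theorem cumProd_succ {n : ℕ} (x : Fin (n + 1) → G) (j : Fin n) :
    cumProd (n + 1) x j.succ = x j.succ * cumProd (n + 1) x j.castSucc := by
  have hIic : Finset.Iic j.succ = insert j.succ (Finset.Iic j.castSucc) := by
    ext i
    simp only [Finset.mem_Iic, Finset.mem_insert, Fin.le_def, Fin.ext_iff, Fin.val_succ,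
      Fin.val_castSucc]
    omega
  change ∏ i ∈ Finset.Iic j.succ, x i = _
  rw [hIic, Finset.prod_insert (by simp [Fin.le_def])]
  rfl

theorem cumProd_eq_of_succ {n : ℕ} {x y : Fin (n + 1) → G} (h_zero : x 0 = y 0)
    (h_succ : ∀ j : Fin n, x j.succ * y j.castSucc = y j.succ) : cumProd (n + 1) x = y := by
  ext1 j
  induction j using Fin.induction with
  | zero => rw [cumProd_zero, h_zero]
  | succ j ih => rw [cumProd_succ, ih, h_succ]

theorem cumProd_surjective (n : ℕ) :
    Function.Surjective (cumProd (n + 1) : (Fin (n + 1) → G) →* (Fin (n + 1) → G)) := fun y =>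
  ⟨Fin.cons (y 0) fun j => y j.succ / y j.castSucc, cumProd_eq_of_succ (by simp) fun j => by simp⟩

theorem measurePreserving_cumProd [TopologicalSpace G] [IsTopologicalGroup G] [CompactSpace G]
    [SecondCountableTopology G] [MeasurableSpace G] [BorelSpace G] (μ : Measure G)
    [μ.IsHaarMeasure] (n : ℕ) :
    MeasurePreserving (cumProd (n + 1)) (Measure.pi fun _ : Fin (n + 1) => μ)
      (Measure.pi fun _ => μ) :=
  MonoidHom.measurePreserving (continuous_cumProd _) (cumProd_surjective n) rfl

/-- The random walk `k ↦ ξ₀ ξ₁ ⋯ ξ_k` with steps `ξ`; the step `ξ₀` is its starting point. -/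
def walk (ξ : ℕ → G) (k : ℕ) : G := ∏ i ∈ Finset.range (k + 1), ξ i

theorem measurable_walk [MeasurableSpace G] [MeasurableMul₂ G] (k : ℕ) :
    Measurable fun ξ : ℕ → G => walk ξ k :=
  Finset.measurable_prod _ fun i _ => measurable_pi_apply i

theorem cumProd_restrict (n : ℕ) (ξ : ℕ → G) :
    cumProd (n + 1) (fun i => ξ i) = fun j : Fin (n + 1) => walk ξ j :=
  cumProd_eq_of_succ (by simp [walk]) fun j => by
    simp [walk, Finset.prod_range_succ _ ((j : ℕ) + 1), mul_comm]

end CumProd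

namespace XYChain

theorem arcLength_eq_map_homeomorphCircle' [Fact (0 < 2 * Real.pi)] :
    arcLength = (volume : Measure (AddCircle (2 * Real.pi))).map AddCircle.homeomorphCircle' := by
  have h := AddCircle.measurePreserving_mk (2 * Real.pi) (-Real.pi)
  rw [← h.map_eq, Measure.map_map AddCircle.homeomorphCircle'.continuous.measurable h.measurable,
    show -Real.pi + 2 * Real.pi = Real.pi by ring]
  rfl

theorem homeomorphCircle'_add (x y : AddCircle (2 * Real.pi)) :
    AddCircle.homeomorphCircle' (x + y)
      = AddCircle.homeomorphCircle' x * AddCircle.homeomorphCircle' y := by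
  induction x using QuotientAddGroup.induction_on with | _ x =>
  induction y using QuotientAddGroup.induction_on with | _ y =>
  exact Circle.exp_add x y

instance : arcLength.IsMulLeftInvariant where
  map_mul_left_eq_self g := by
    have : Fact (0 < 2 * Real.pi) := ⟨Real.two_pi_pos⟩
    have hφ := AddCircle.homeomorphCircle'.continuous.measurable
    obtain ⟨a, rfl⟩ := AddCircle.homeomorphCircle'.surjective g
    have hcomm : (AddCircle.homeomorphCircle' a * ·) ∘ AddCircle.homeomorphCircle'
        = AddCircle.homeomorphCircle' ∘ (a + ·) :=
      funext fun x => (homeomorphCircle'_add a x).symm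
    rw [arcLength_eq_map_homeomorphCircle', Measure.map_map (by fun_prop) hφ, hcomm,
      ← Measure.map_map hφ (by fun_prop), map_add_left_eq_self]

instance : arcLength.IsHaarMeasure :=
  Measure.isHaarMeasure_of_isCompact_nonempty_interior arcLength univ isCompact_univ
    (by simp) (by simpa using NeZero.ne arcLength) (measure_ne_top _ _)

/-- The von Mises law with concentration parameter `β`: its density with respect to arc length is
proportional to `exp (β cos θ)` at `e^{iθ}`. -/
def vonMises (β : ℝ) : Measure Circle := arcLength.tilted fun z => β * (z : ℂ).re

instance (β : ℝ) : IsProbabilityMeasure (vonMises β) :=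
  isProbabilityMeasure_tilted (Continuous.integrable_of_hasCompactSupport (by fun_prop)
    (HasCompactSupport.of_compactSpace _))

/-- The law of an infinite sequence of independent steps `ξ₀, ξ₁, …` on the circle, where `ξ₀` is
uniform (von Mises with parameter `0`) and the others are von Mises with parameter `β`. -/
def steps (β : ℝ) : Measure (ℕ → Circle) :=
  Measure.infinitePi fun i => vonMises (if i = 0 then 0 else β)

instance (β : ℝ) : IsProbabilityMeasure (steps β) := by unfold steps; infer_instance

theorem map_steps_restrict (β : ℝ) (n : ℕ) : (steps β).map (fun ξ (i : Fin n) => ξ i)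
    = Measure.pi fun i : Fin n => vonMises (if (i : ℕ) = 0 then 0 else β) := by
  rw [steps, Measure.map_infinitePi_infinitePi_of_inj Fin.val_injective, Measure.infinitePi_eq_pi]

theorem inner_mul_left_eq_re (x y : Circle) :
    inner ℝ (x : ℂ) ((y * x : Circle) : ℂ) = (y : ℂ).re := by
  rw [Complex.inner, Circle.coe_mul, mul_assoc, Complex.mul_conj, Circle.normSq_coe,
    Complex.ofReal_one, mul_one]

theorem hamiltonian_cumProd (n : ℕ) (x : Fin (n + 1) → Circle) :
    hamiltonian n (cumProd (n + 1) x) = -∑ j : Fin n, (x j.succ : ℂ).re := by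
  simp only [hamiltonian, cumProd_succ, inner_mul_left_eq_re]

theorem gibbs_eq_map_cumProd (n : ℕ) (β : ℝ) :
    gibbs n β = (Measure.pi fun i : Fin (n + 1) =>
      vonMises (if (i : ℕ) = 0 then 0 else β)).map (cumProd (n + 1)) := by
  have hH : Measurable fun S : Fin (n + 1) → Circle => -β * hamiltonian n S := by
    refine Continuous.measurable ?_
    unfold hamiltonian; fun_prop
  simp only [gibbs, vonMises]
  rw [← (measurePreserving_cumProd arcLength n).map_eq,
    tilted_map (continuous_cumProd (n + 1)).measurable hH, ← pi_tilted_sum]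
  congr 2
  ext x
  simp [hamiltonian_cumProd, Fin.sum_univ_succ, Finset.mul_sum]

theorem gibbs_eq_map_walk (n : ℕ) (β : ℝ) :
    gibbs n β = (steps β).map fun ξ (j : Fin (n + 1)) => walk ξ j := by
  rw [gibbs_eq_map_cumProd, ← map_steps_restrict,
    Measure.map_map (continuous_cumProd (n + 1)).measurable (by fun_prop)]
  exact congrArg ((steps β).map ·) (funext fun ξ => cumProd_restrict n ξ)

end XYChain

section Laplace

theorem tendsto_mul_one_sub_cos (c : ℝ) :
    Tendsto (fun β : ℝ => β * (1 - Real.cos (c / √β))) atTop (𝓝 (c ^ 2 / 2)) := by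
  have hsinc : Tendsto (fun β : ℝ => c ^ 2 / 2 * Real.sinc (c / √β / 2) ^ 2) atTop
      (𝓝 (c ^ 2 / 2)) := by
    have harg : Tendsto (fun β : ℝ => c / √β / 2) atTop (𝓝 0) := by
      simpa using (tendsto_const_nhds.div_atTop Real.tendsto_sqrt_atTop (a := c)).div_const 2
    simpa using (((Real.continuous_sinc.tendsto 0).comp harg).pow 2).const_mul (c ^ 2 / 2)
  refine hsinc.congr' ?_
  filter_upwards [eventually_gt_atTop 0] with β hβ
  rcases eq_or_ne c 0 with rfl | hc
  · simp
  have hy : c / √β / 2 ≠ 0 := by positivity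
  have hcos : Real.cos (c / √β) = 1 - 2 * Real.sin (c / √β / 2) ^ 2 := by
    rw [← Real.cos_two_mul_eq_one_sub, mul_div_cancel₀ _ two_ne_zero]
  rw [hcos, Real.sinc_of_ne_zero hy, div_pow, div_pow, div_pow, Real.sq_sqrt hβ.le]
  field_simp
  ring

theorem mul_cos_sub_one_le {β x : ℝ} (hβ : 0 < β) (hx : |x / √β| ≤ Real.pi) :
    β * (Real.cos (x / √β) - 1) ≤ -(2 / Real.pi ^ 2) * x ^ 2 := by
  have h := Real.cos_le_one_sub_mul_cos_sq hx
  rw [div_pow, Real.sq_sqrt hβ.le] at h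
  calc β * (Real.cos (x / √β) - 1) ≤ β * (-(2 / Real.pi ^ 2 * (x ^ 2 / β))) := by
        gcongr; linarith
    _ = _ := by field_simp

theorem mul_one_sub_cos_le {β : ℝ} (hβ : 0 < β) (x : ℝ) :
    β * (1 - Real.cos (x / √β)) ≤ x ^ 2 / 2 := by
  have h := Real.one_sub_sq_div_two_le_cos (x := x / √β)
  rw [div_pow, Real.sq_sqrt hβ.le] at h
  calc β * (1 - Real.cos (x / √β)) ≤ β * (x ^ 2 / β / 2) := by gcongr; linarith
    _ = _ := by field_simp

theorem sqrt_mul_setIntegral_eq_integral_div_sqrt {β : ℝ} (hβ : 0 < β) {s : Set ℝ}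
    (hs : MeasurableSet s) (g : ℝ → ℝ) :
    √β * ∫ θ in s, g θ = ∫ x, s.indicator g (x / √β) := by
  rw [Measure.integral_comp_div, integral_indicator hs, abs_of_pos (Real.sqrt_pos.2 hβ),
    smul_eq_mul]

theorem integral_mul_exp_neg_sq_div_two (H : ℝ → ℝ) :
    ∫ x, H x * Real.exp (-(x ^ 2 / 2)) = √(2 * Real.pi) * ∫ x, H x ∂gaussianReal 0 1 := by
  rw [integral_gaussianReal_eq_integral_smul one_ne_zero, ← integral_const_mul]
  congr 1
  ext x
  have : √(2 * Real.pi) ≠ 0 := by positivity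
  simp only [gaussianPDFReal, NNReal.coe_one, mul_one, sub_zero, smul_eq_mul, neg_div]
  field_simp

theorem integrable_add_mul_sq_mul_exp_neg_mul_sq {c : ℝ} (hc : 0 < c) (A C : ℝ) :
    Integrable fun x : ℝ => (A + C * x ^ 2) * Real.exp (-c * x ^ 2) := by
  have h_sq := integrable_rpow_mul_exp_neg_mul_sq hc (s := 2) (by norm_num)
  refine (((integrable_exp_neg_mul_sq hc).const_mul A).add (h_sq.const_mul C)).congr
    (Eventually.of_forall fun x => ?_)
  simp only [Pi.add_apply, Real.rpow_ofNat]
  ring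

/-- Laplace's method: on the scale `θ = x / √β` the weight `exp (β (cos θ - 1))` converges to
`exp (-x² / 2)`, and it is dominated by a Gaussian because `1 - cos θ ≥ 2θ²/π²` on `[-π, π]`. -/
theorem tendsto_sqrt_mul_setIntegral_exp_cos {h : ℝ → ℝ → ℝ} {H : ℝ → ℝ} {A C : ℝ}
    (hm : ∀ β, Measurable (h β)) (hb : ∀ β > 0, ∀ x, |h β (x / √β)| ≤ A + C * x ^ 2)
    (hlim : ∀ x, Tendsto (fun β => h β (x / √β)) atTop (𝓝 (H x))) :
    Tendsto (fun β : ℝ => √β * ∫ θ in Ioc (-Real.pi) Real.pi,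
      h β θ * Real.exp (β * (Real.cos θ - 1))) atTop
      (𝓝 (√(2 * Real.pi) * ∫ x, H x ∂gaussianReal 0 1)) := by
  set s := Ioc (-Real.pi) Real.pi
  set F : ℝ → ℝ → ℝ := fun β => s.indicator fun θ => h β θ * Real.exp (β * (Real.cos θ - 1))
  have hF : ∀ β, Measurable (F β) := fun β =>
    ((hm β).mul (by fun_prop)).indicator measurableSet_Ioc
  rw [← integral_mul_exp_neg_sq_div_two]
  suffices Tendsto (fun β => ∫ x, F β (x / √β)) atTop
      (𝓝 (∫ x, H x * Real.exp (-(x ^ 2 / 2)))) by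
    refine this.congr' ?_
    filter_upwards [eventually_gt_atTop 0] with β hβ
    rw [sqrt_mul_setIntegral_eq_integral_div_sqrt hβ measurableSet_Ioc]
  refine tendsto_integral_filter_of_dominated_convergence _
    (Eventually.of_forall fun β => ((hF β).comp (measurable_id.div_const _)).aestronglyMeasurable)
    ?_ (integrable_add_mul_sq_mul_exp_neg_mul_sq (c := 2 / Real.pi ^ 2) (by positivity) A C)
    (Eventually.of_forall fun x => ?_)
  · filter_upwards [eventually_gt_atTop 0] with β hβ
    refine Eventually.of_forall fun x => ?_
    have hA := (abs_nonneg _).trans (hb β hβ x)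
    by_cases hx : x / √β ∈ s
    · simp only [F]
      rw [indicator_of_mem hx, norm_mul, Real.norm_eq_abs, Real.norm_eq_abs, Real.abs_exp]
      exact mul_le_mul (hb β hβ x)
        (Real.exp_le_exp.2 (mul_cos_sub_one_le hβ (abs_le.2 ⟨hx.1.le, hx.2⟩)))
        (Real.exp_nonneg _) hA
    · simp only [F]
      rw [indicator_of_notMem hx, norm_zero]
      positivity
  · have hexp := (Real.continuous_exp.tendsto _).comp (tendsto_mul_one_sub_cos x).neg
    have hmem : ∀ᶠ β : ℝ in atTop, x / √β ∈ s :=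
      (tendsto_const_nhds.div_atTop Real.tendsto_sqrt_atTop).eventually
        (Ioc_mem_nhds (by simp [Real.pi_pos]) Real.pi_pos)
    refine ((hlim x).mul hexp).congr' ?_
    filter_upwards [hmem] with β hx
    simp only [F]
    rw [indicator_of_mem hx, Function.comp_apply, ← mul_neg, neg_sub]

theorem integral_sq_gaussianReal : ∫ x, x ^ 2 ∂gaussianReal 0 1 = 1 := by
  have h := variance_id_gaussianReal (μ := 0) (v := 1)
  rw [variance_eq_integral aemeasurable_id] at h
  simpa using h

theorem tendsto_pow_exp_of_tendsto {a : ℕ → ℝ} {ℓ : ℕ → ℕ} {x τ : ℝ}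
    (ha : Tendsto (fun n : ℕ => n * (a n - 1)) atTop (𝓝 x))
    (hℓ : Tendsto (fun n : ℕ => (ℓ n : ℝ) / n) atTop (𝓝 τ)) :
    Tendsto (fun n => a n ^ ℓ n) atTop (𝓝 (Real.exp (τ * x))) := by
  have hlog := Real.tendsto_nat_mul_log_one_add_of_tendsto ha
  have hpos : ∀ᶠ n in atTop, 0 < a n := by
    filter_upwards [(tendsto_zero_of_tendsto_mul_atTop ha).eventually_const_lt neg_one_lt_zero]
      with n hn
    linarith
  refine ((Real.continuous_exp.tendsto _).comp (hℓ.mul hlog)).congr' ?_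
  filter_upwards [eventually_ne_atTop 0, hpos] with n hn han
  have hn' : (n : ℝ) ≠ 0 := mod_cast hn
  rw [Function.comp_apply, add_sub_cancel, ← mul_assoc, div_mul_cancel₀ _ hn', Real.exp_nat_mul,
    Real.exp_log han]

end Laplace

namespace XYChain

theorem integral_vonMises (β : ℝ) {g : Circle → ℝ} (hg : Measurable g) :
    ∫ z, g z ∂vonMises β = (∫ θ in Ioc (-Real.pi) Real.pi,
        g (Circle.exp θ) * Real.exp (β * (Real.cos θ - 1)))
      / ∫ θ in Ioc (-Real.pi) Real.pi, Real.exp (β * (Real.cos θ - 1)) := by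
  have hexp : Measurable Circle.exp := Circle.exp.continuous.measurable
  have hre : ∀ θ : ℝ, (Circle.exp θ : ℂ).re = Real.cos θ := fun θ => by
    rw [Circle.coe_exp, Complex.exp_ofReal_mul_I_re]
  have hshift : ∀ θ : ℝ, Real.exp (β * (Real.cos θ - 1))
      = Real.exp (-β) * Real.exp (β * Real.cos θ) := fun θ => by
    rw [← Real.exp_add]; ring_nf
  rw [vonMises, integral_tilted, arcLength, integral_map hexp.aemeasurable (by fun_prop),
    integral_map hexp.aemeasurable (by fun_prop)]
  simp_rw [hre, hshift, mul_left_comm _ (Real.exp (-β))]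
  rw [integral_const_mul, integral_const_mul, mul_div_mul_left _ _ (Real.exp_ne_zero _),
    ← integral_div]
  simp_rw [smul_eq_mul, div_mul_eq_mul_div, mul_comm]

theorem tendsto_integral_vonMises {h : ℝ → Circle → ℝ} {H : ℝ → ℝ} {A C : ℝ}
    (hm : ∀ β, Measurable (h β)) (hb : ∀ β > 0, ∀ x, |h β (Circle.exp (x / √β))| ≤ A + C * x ^ 2)
    (hlim : ∀ x, Tendsto (fun β => h β (Circle.exp (x / √β))) atTop (𝓝 (H x))) :
    Tendsto (fun β => ∫ z, h β z ∂vonMises β) atTop (𝓝 (∫ x, H x ∂gaussianReal 0 1)) := by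
  have hnum := tendsto_sqrt_mul_setIntegral_exp_cos (h := fun β θ => h β (Circle.exp θ))
    (fun β => (hm β).comp Circle.exp.continuous.measurable) hb hlim
  have hden := tendsto_sqrt_mul_setIntegral_exp_cos (h := fun _ _ => 1) (H := fun _ => 1)
    (A := 1) (C := 0) (by fun_prop) (by simp) (fun _ => tendsto_const_nhds)
  have hne : √(2 * Real.pi) ≠ 0 := by positivity
  simp only [one_mul, integral_const, probReal_univ, smul_eq_mul, mul_one] at hden
  have hdiv := hnum.div hden hne
  rw [mul_div_cancel_left₀ _ hne] at hdiv
  refine hdiv.congr' ?_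
  filter_upwards [eventually_gt_atTop 0] with β hβ
  rw [Pi.div_apply, mul_div_mul_left _ _ (Real.sqrt_pos.2 hβ).ne', integral_vonMises β (hm β)]

theorem continuous_coe_zpow (k : ℤ) : Continuous fun z : Circle => ((z ^ k : Circle) : ℂ) :=
  continuous_induced_dom.comp (continuous_zpow k)

/-- The `k`-th Fourier coefficient `𝔼 z ^ k` of the von Mises law; it is real because the law is
invariant under conjugation, see `integral_zpow_vonMises`. -/
def vonMisesCoeff (β : ℝ) (k : ℤ) : ℝ := ∫ z : Circle, ((z ^ k : Circle) : ℂ).re ∂vonMises β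

theorem map_inv_vonMises (β : ℝ) : (vonMises β).map (·⁻¹) = vonMises β := by
  have hf : (fun z : Circle => β * (z : ℂ).re) ∘ (·⁻¹) = fun z : Circle => β * (z : ℂ).re := by
    ext z
    simp
  have hinv : arcLength.map Inv.inv = arcLength := Measure.map_inv_eq_self arcLength
  have h := tilted_map (μ := arcLength) (measurable_inv (G := Circle))
    (f := fun z : Circle => β * (z : ℂ).re) (by fun_prop)
  rw [hf, hinv] at h
  exact h.symm

theorem integral_zpow_vonMises (β : ℝ) (k : ℤ) :
    ∫ z : Circle, ((z ^ k : Circle) : ℂ) ∂vonMises β = vonMisesCoeff β k := by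
  have hint : Integrable (fun z : Circle => ((z ^ k : Circle) : ℂ)) (vonMises β) :=
    (continuous_coe_zpow k).integrable_of_hasCompactSupport (HasCompactSupport.of_compactSpace _)
  have him : ∫ z : Circle, ((z ^ k : Circle) : ℂ).im ∂vonMises β = 0 := by
    refine self_eq_neg.1 ?_
    calc ∫ z : Circle, ((z ^ k : Circle) : ℂ).im ∂vonMises β
        = ∫ z : Circle, ((z ^ k : Circle) : ℂ).im ∂(vonMises β).map (·⁻¹) := by
          rw [map_inv_vonMises]
      _ = ∫ z : Circle, ((z⁻¹ ^ k : Circle) : ℂ).im ∂vonMises β :=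
          integral_map measurable_inv.aemeasurable
            (Complex.continuous_im.comp (continuous_coe_zpow k)).aestronglyMeasurable
      _ = _ := by
          rw [← integral_neg]
          simp only [inv_zpow, Circle.coe_inv_eq_conj, Complex.conj_im]
  rw [← integral_re_add_im hint]
  simp only [RCLike.re_eq_complex_re, RCLike.im_eq_complex_im, him, vonMisesCoeff]
  simp

theorem re_exp_zpow (k : ℤ) (θ : ℝ) : ((Circle.exp θ ^ k : Circle) : ℂ).re = Real.cos (k * θ) := by
  rw [← Circle.exp_zsmul, Circle.coe_exp, Complex.exp_ofReal_mul_I_re, zsmul_eq_mul]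

theorem tendsto_mul_one_sub_vonMisesCoeff (k : ℤ) :
    Tendsto (fun β : ℝ => β * (1 - vonMisesCoeff β k)) atTop (𝓝 (k ^ 2 / 2)) := by
  have hre := (Complex.continuous_re.comp (continuous_coe_zpow k)).measurable
  have hcos : ∀ β x : ℝ, β * (1 - ((Circle.exp (x / √β) ^ k : Circle) : ℂ).re)
      = β * (1 - Real.cos (k * x / √β)) := fun β x => by rw [re_exp_zpow, mul_div_assoc]
  have h := tendsto_integral_vonMises (h := fun β z => β * (1 - ((z ^ k : Circle) : ℂ).re))
    (H := fun x => k ^ 2 / 2 * x ^ 2) (A := 0) (C := k ^ 2 / 2)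
    (fun β => (measurable_const.sub hre).const_mul β)
    (fun β hβ x => by
      rw [hcos, abs_of_nonneg (mul_nonneg hβ.le (sub_nonneg.2 (Real.cos_le_one _)))]
      linarith [mul_one_sub_cos_le hβ (k * x)])
    (fun x => by
      simp_rw [hcos]
      convert! tendsto_mul_one_sub_cos (k * x) using 2
      ring)
  rw [integral_const_mul, integral_sq_gaussianReal, mul_one] at h
  refine h.congr fun β => ?_
  have hint : Integrable (fun z : Circle => ((z ^ k : Circle) : ℂ).re) (vonMises β) :=
    (Complex.continuous_re.comp (continuous_coe_zpow k)).integrable_of_hasCompactSupport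
      (HasCompactSupport.of_compactSpace _)
  rw [integral_const_mul, integral_sub (integrable_const _) hint]
  simp [vonMisesCoeff]

section Scaling

variable {β : ℕ → ℝ} {b : ℝ}

theorem tendsto_atTop_of_tendsto_div (hb : 0 < b)
    (hβ : Tendsto (fun n : ℕ => β n / (n : ℝ)) atTop (𝓝 b)) : Tendsto β atTop atTop := by
  refine (hβ.pos_mul_atTop hb tendsto_natCast_atTop_atTop).congr' ?_
  filter_upwards [eventually_ne_atTop 0] with n hn
  exact div_mul_cancel₀ _ (mod_cast hn)

theorem tendsto_mul_vonMisesCoeff_sub_one (hb : 0 < b)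
    (hβ : Tendsto (fun n : ℕ => β n / (n : ℝ)) atTop (𝓝 b)) (k : ℤ) :
    Tendsto (fun n : ℕ => n * (vonMisesCoeff (β n) k - 1)) atTop (𝓝 (-(k ^ 2 / 2 / b))) := by
  have hβtop := tendsto_atTop_of_tendsto_div hb hβ
  refine (((tendsto_mul_one_sub_vonMisesCoeff k).comp hβtop).div hβ hb.ne').neg.congr' ?_
  filter_upwards [eventually_ne_atTop 0, hβtop.eventually_gt_atTop 0] with n hn hβn
  have hn' : (n : ℝ) ≠ 0 := mod_cast hn
  simp only [Function.comp_apply, Pi.div_apply]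
  field_simp
  ring

theorem tendsto_vonMisesCoeff_pow (hb : 0 < b)
    (hβ : Tendsto (fun n : ℕ => β n / (n : ℝ)) atTop (𝓝 b)) (k : ℤ) {ℓ : ℕ → ℕ} {τ : ℝ}
    (hℓ : Tendsto (fun n : ℕ => (ℓ n : ℝ) / n) atTop (𝓝 τ)) :
    Tendsto (fun n => vonMisesCoeff (β n) k ^ ℓ n) atTop
      (𝓝 (Real.exp (-(k ^ 2 * τ / (2 * b))))) := by
  convert! tendsto_pow_exp_of_tendsto (tendsto_mul_vonMisesCoeff_sub_one hb hβ k) hℓ using 3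
  field_simp

end Scaling

end XYChain

section Torus

variable {ι : Type*} [Fintype ι]

/-- The character `x ↦ ∏ i, x i ^ k i` of the torus `ι → Circle` with frequency vector `k`, as a
bounded continuous complex-valued function. -/
def torusChar (k : ι → ℤ) : BoundedContinuousFunction (ι → Circle) ℂ :=
  .mkOfCompact ⟨fun x => ((∏ i, x i ^ k i : Circle) : ℂ), by fun_prop⟩

theorem torusChar_apply (k : ι → ℤ) (x : ι → Circle) :
    torusChar k x = ((∏ i, x i ^ k i : Circle) : ℂ) := rfl

theorem torusChar_apply_eq_prod (k : ι → ℤ) (x : ι → Circle) :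
    torusChar k x = ∏ i, ((x i ^ k i : Circle) : ℂ) :=
  map_prod Circle.coeHom _ _

theorem torusChar_zero : torusChar (0 : ι → ℤ) = 1 := by
  ext x; simp [torusChar_apply]

theorem torusChar_add (k l : ι → ℤ) : torusChar (k + l) = torusChar k * torusChar l := by
  ext x
  simp only [torusChar_apply, BoundedContinuousFunction.mul_apply, ← Circle.coe_mul, Pi.add_apply,
    zpow_add, Finset.prod_mul_distrib]

theorem torusChar_neg (k : ι → ℤ) : torusChar (-k) = star (torusChar k) := by
  ext x
  simp only [torusChar_apply, BoundedContinuousFunction.star_apply, Pi.neg_apply, zpow_neg,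
    Finset.prod_inv_distrib, Circle.coe_inv_eq_conj]
  rfl

variable (ι) in
/-- The trigonometric polynomials: the star subalgebra of bounded continuous functions generated by
the characters of the torus. -/
def trigPolynomials : StarSubalgebra ℂ (BoundedContinuousFunction (ι → Circle) ℂ) where
  toSubalgebra := Algebra.adjoin ℂ (range torusChar)
  star_mem' := by
    change Algebra.adjoin ℂ (range torusChar) ≤ star (Algebra.adjoin ℂ (range torusChar))
    refine Algebra.adjoin_le ?_
    rintro _ ⟨k, rfl⟩
    exact Algebra.subset_adjoin ⟨-k, torusChar_neg k⟩

theorem trigPolynomials_toSubmodule :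
    (trigPolynomials ι).toSubalgebra.toSubmodule = Submodule.span ℂ (range torusChar) := by
  apply Algebra.adjoin_eq_span_of_subset
  refine .trans (fun x => Submonoid.closure_induction (fun _ => id) ⟨0, torusChar_zero⟩ ?_)
    Submodule.subset_span
  rintro _ _ _ _ ⟨k, rfl⟩ ⟨l, rfl⟩
  exact ⟨k + l, torusChar_add k l⟩

theorem separatesPoints_trigPolynomials :
    ((trigPolynomials ι).map
      (BoundedContinuousFunction.toContinuousMapStarₐ ℂ)).SeparatesPoints := by
  classical
  intro x y hxy
  obtain ⟨i, hi⟩ := Function.ne_iff.1 hxy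
  refine ⟨_, ⟨_, ⟨torusChar (Pi.single i 1), Algebra.subset_adjoin ⟨_, rfl⟩, rfl⟩, rfl⟩, ?_⟩
  have h : ∀ z : ι → Circle, torusChar (Pi.single i 1) z = z i := fun z => by
    rw [torusChar_apply, Finset.prod_eq_single i (fun j _ hj => by simp [hj]) (by simp)]
    simp
  exact fun hxy' => hi (Circle.ext ((h x).symm.trans (hxy'.trans (h y))))

/-- Lévy's continuity theorem on the torus. -/
theorem tendsto_of_tendsto_integral_torusChar {γ : Type*} {l : Filter γ}
    {μ : γ → ProbabilityMeasure (ι → Circle)} {ν : ProbabilityMeasure (ι → Circle)}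
    (h : ∀ k : ι → ℤ, Tendsto (fun i => ∫ x, torusChar k x ∂(μ i)) l
      (𝓝 (∫ x, torusChar k x ∂ν))) : Tendsto μ l (𝓝 ν) := by
  refine ProbabilityMeasure.tendsto_of_tight_of_separatesPoints ℂ
    .of_compactSpace separatesPoints_trigPolynomials fun g hg => ?_
  replace hg : g ∈ Submodule.span ℂ (range torusChar) := trigPolynomials_toSubmodule (ι := ι) ▸ hg
  induction hg using Submodule.span_induction with
  | mem p hp =>
    obtain ⟨k, rfl⟩ := hp
    exact h k
  | zero => simp [tendsto_const_nhds]
  | add p q _ _ hp hq =>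
    simp only [BoundedContinuousFunction.add_apply]
    simpa only [integral_add (p.integrable _) (q.integrable _)] using hp.add hq
  | smul c p _ hp =>
    simpa only [BoundedContinuousFunction.smul_apply, integral_smul] using hp.const_smul c

theorem tendstoInDistribution_of_tendsto_integral_torusChar {γ : Type*} {l : Filter γ}
    {Ω : γ → Type*} [∀ i, MeasurableSpace (Ω i)] {μ : ∀ i, Measure (Ω i)}
    [∀ i, IsProbabilityMeasure (μ i)] {Ω' : Type*} [MeasurableSpace Ω'] {μ' : Measure Ω'}
    [IsProbabilityMeasure μ'] {X : ∀ i, Ω i → ι → Circle} {Z : Ω' → ι → Circle}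
    (hX : ∀ i, AEMeasurable (X i) (μ i)) (hZ : AEMeasurable Z μ')
    (h : ∀ k : ι → ℤ, Tendsto (fun i => ∫ ω, torusChar k (X i ω) ∂(μ i)) l
      (𝓝 (∫ ω, torusChar k (Z ω) ∂μ'))) : TendstoInDistribution X l Z μ μ' := by
  refine ⟨hX, hZ, tendsto_of_tendsto_integral_torusChar fun k => ?_⟩
  simp only [ProbabilityMeasure.coe_mk]
  rw [integral_map hZ (by fun_prop)]
  exact (h k).congr fun i => (integral_map (hX i) (by fun_prop)).symm

end Torus

section Ottaviani

theorem measurable_prod_iSup_comap {Ω κ G : Type*} [CommMonoid G] [MeasurableSpace G]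
    [MeasurableMul₂ G] (X : κ → Ω → G) {B : Finset κ} {S : Set κ} (hBS : ∀ r ∈ B, r ∈ S) :
    Measurable[⨆ r ∈ S, MeasurableSpace.comap (X r) inferInstance] fun ω => ∏ r ∈ B, X r ω :=
  Finset.measurable_fun_prod _ fun r hr =>
    (comap_measurable (X r)).mono (le_iSup₂_of_le r (hBS r hr) le_rfl) le_rfl

variable {Ω : Type*} [MeasurableSpace Ω] {μ : Measure Ω}

theorem measureReal_biUnion_range_le_mul [IsFiniteMeasure μ] {A C : ℕ → Set Ω} {F : Set Ω} {c : ℝ}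
    {n : ℕ} (hA : ∀ i, MeasurableSet (A i)) (hC : ∀ i, MeasurableSet (C i)) (hc : 0 ≤ c)
    (hAC : ∀ i < n, μ.real (disjointed A i) ≤ c * μ.real (disjointed A i ∩ C i))
    (hF : ∀ i < n, A i ∩ C i ⊆ F) : μ.real (⋃ i ∈ Finset.range n, A i) ≤ c * μ.real F := by
  have hunion : ⋃ i ∈ Finset.range n, A i = ⋃ i ∈ Finset.range n, disjointed A i := by
    cases n with
    | zero => simp
    | succ n =>
      rw [biUnion_range_succ_disjointed, partialSups_eq_biUnion_range]
  have hdisj : (Finset.range n : Set ℕ).PairwiseDisjoint fun i => disjointed A i ∩ C i :=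
    fun i _ j _ hij => (disjoint_disjointed A hij).mono inter_subset_left inter_subset_left
  calc μ.real (⋃ i ∈ Finset.range n, A i) ≤ ∑ i ∈ Finset.range n, μ.real (disjointed A i) := by
        rw [hunion]
        exact measureReal_biUnion_finset_le _ _
    _ ≤ ∑ i ∈ Finset.range n, c * μ.real (disjointed A i ∩ C i) :=
        Finset.sum_le_sum fun i hi => hAC i (Finset.mem_range.1 hi)
    _ = c * μ.real (⋃ i ∈ Finset.range n, disjointed A i ∩ C i) := by
        rw [← Finset.mul_sum, measureReal_biUnion_finset hdisj fun i _ =>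
          (MeasurableSet.disjointed hA i).inter (hC i)]
    _ ≤ c * μ.real F := by
        refine mul_le_mul_of_nonneg_left (measureReal_mono (iUnion₂_subset fun i hi => ?_)) hc
        exact (inter_subset_inter_left _ (disjointed_subset A i)).trans
          (hF i (Finset.mem_range.1 hi))

variable {G : Type*} [CommGroup G] [PseudoMetricSpace G] [MeasurableSpace G]
  [OpensMeasurableSpace G] [MeasurableMul₂ G] {X : ℕ → Ω → G}

/-- The first exit from the ball of radius `2 * ε` happens at time `i` on an event determined by the
factors before `i`, which is independent of the remaining factors. -/
theorem measureReal_disjointed_inter_eq_mul (hX : iIndepFun X μ) (hXm : ∀ r, Measurable (X r))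
    (ε : ℝ) (i n : ℕ) :
    μ.real (disjointed (fun j => {ω | 2 * ε < dist (∏ r ∈ Finset.range j, X r ω) 1}) i
        ∩ {ω | dist (∏ r ∈ Finset.Ico i n, X r ω) 1 ≤ ε})
      = μ.real (disjointed (fun j => {ω | 2 * ε < dist (∏ r ∈ Finset.range j, X r ω) 1}) i)
        * μ.real {ω | dist (∏ r ∈ Finset.Ico i n, X r ω) 1 ≤ ε} := by
  have hdist : Measurable fun g : G => dist g 1 := (continuous_id.dist continuous_const).measurable
  have hindep := indep_iSup_of_disjoint (fun r => (hXm r).comap_le) hX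
    (S := Iio i) (T := Ici i) (disjoint_left.2 fun _ h h' => not_le.2 (mem_Iio.1 h) (mem_Ici.1 h'))
  have hpast : ∀ j ≤ i, MeasurableSet[⨆ r ∈ Iio i, MeasurableSpace.comap (X r) inferInstance]
      {ω | 2 * ε < dist (∏ r ∈ Finset.range j, X r ω) 1} := fun j hj =>
    (hdist.comp (measurable_prod_iSup_comap X fun r hr =>
      (Finset.mem_range.1 hr).trans_le hj)) measurableSet_Ioi
  have hfuture : MeasurableSet[⨆ r ∈ Ici i, MeasurableSpace.comap (X r) inferInstance]
      {ω | dist (∏ r ∈ Finset.Ico i n, X r ω) 1 ≤ ε} :=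
    (hdist.comp (measurable_prod_iSup_comap X fun r hr => (Finset.mem_Ico.1 hr).1))
      measurableSet_Iic
  rw [measureReal_def, ((Indep_iff _ _ _).1 hindep) _ _ ?_ hfuture, ENNReal.toReal_mul]
  · rfl
  · rw [disjointed_eq_inter_compl]
    exact (hpast i le_rfl).inter (.iInter fun j => .iInter fun hj => (hpast j hj.le).compl)

theorem ottaviani [IsIsometricSMul G G] (hX : iIndepFun X μ) (hXm : ∀ r, Measurable (X r)) {ε : ℝ}
    {n : ℕ} (hε : ∀ i ≤ n, μ.real {ω | ε < dist (∏ r ∈ Finset.Ico i n, X r ω) 1} ≤ 1 / 2) :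
    μ.real {ω | ∃ i ≤ n, 2 * ε < dist (∏ r ∈ Finset.range i, X r ω) 1}
      ≤ 2 * μ.real {ω | ε < dist (∏ r ∈ Finset.range n, X r ω) 1} := by
  have := hX.isProbabilityMeasure
  have hdist : ∀ B : Finset ℕ, Measurable fun ω => dist (∏ r ∈ B, X r ω) 1 := fun B =>
    (continuous_id.dist continuous_const).measurable.comp
      (Finset.measurable_fun_prod B fun r _ => hXm r)
  have hC : ∀ i, MeasurableSet {ω | dist (∏ r ∈ Finset.Ico i n, X r ω) 1 ≤ ε} := fun i =>
    hdist _ measurableSet_Iic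
  have hunion : {ω | ∃ i ≤ n, 2 * ε < dist (∏ r ∈ Finset.range i, X r ω) 1}
      = ⋃ i ∈ Finset.range (n + 1), {ω | 2 * ε < dist (∏ r ∈ Finset.range i, X r ω) 1} := by
    ext ω
    simp
  rw [hunion]
  refine measureReal_biUnion_range_le_mul (fun i => hdist _ measurableSet_Ioi) hC zero_le_two
    (fun i hi => ?_) fun i hi ω hω => ?_
  · have hcompl : {ω | dist (∏ r ∈ Finset.Ico i n, X r ω) 1 ≤ ε}ᶜ
        = {ω | ε < dist (∏ r ∈ Finset.Ico i n, X r ω) 1} := by ext; simp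
    have hhalf := hε i (Nat.lt_succ_iff.1 hi)
    rw [← hcompl, probReal_compl_eq_one_sub (hC i)] at hhalf
    rw [measureReal_disjointed_inter_eq_mul hX hXm]
    nlinarith [measureReal_nonneg (μ := μ)
      (s := disjointed (fun j => {ω | 2 * ε < dist (∏ r ∈ Finset.range j, X r ω) 1}) i)]
  · have hsplit := Finset.prod_range_mul_prod_Ico (fun r => X r ω) (Nat.lt_succ_iff.1 hi)
    have htri := dist_triangle_left (∏ r ∈ Finset.range i, X r ω) 1 (∏ r ∈ Finset.range n, X r ω)
    have hend : dist (∏ r ∈ Finset.range n, X r ω) (∏ r ∈ Finset.range i, X r ω)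
        = dist (∏ r ∈ Finset.Ico i n, X r ω) 1 := by
      rw [← hsplit]
      simpa using dist_mul_left (∏ r ∈ Finset.range i, X r ω) (∏ r ∈ Finset.Ico i n, X r ω) 1
    have h_exit : 2 * ε < dist (∏ r ∈ Finset.range i, X r ω) 1 := hω.1
    have h_stay : dist (∏ r ∈ Finset.Ico i n, X r ω) 1 ≤ ε := hω.2
    simp only [mem_ofPred_eq]
    linarith

end Ottaviani

section CircleVariables

variable {Ω : Type*} [MeasurableSpace Ω] {μ : Measure Ω} {κ : Type*} {X : κ → Ω → Circle}

theorem integral_torusChar_prod (hX : iIndepFun X μ) (hXm : ∀ r, Measurable (X r)) {ι : Type*}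
    [Fintype ι] {B : ι → Finset κ} (hB : Pairwise (Function.onFun Disjoint B)) (k : ι → ℤ) :
    ∫ ω, torusChar k (fun i => ∏ r ∈ B i, X r ω) ∂μ
      = ∏ i, ∏ r ∈ B i, ∫ ω, ((X r ω ^ k i : Circle) : ℂ) ∂μ := by
  have hinj : Function.Injective fun p : Σ i, B i => (p.2 : κ) := by
    rintro ⟨i, r, hr⟩ ⟨j, s, hs⟩ (rfl : r = s)
    obtain rfl : i = j := by
      by_contra hij
      exact Finset.disjoint_left.1 (hB hij) hr hs
    rfl
  have hindep : iIndepFun (fun (p : Σ i, B i) ω => ((X p.2 ω ^ k p.1 : Circle) : ℂ)) μ :=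
    (hX.precomp hinj).comp (fun p z => ((z ^ k p.1 : Circle) : ℂ))
      fun p => (XYChain.continuous_coe_zpow _).measurable
  have hmeas : ∀ p : Σ i, B i,
      AEStronglyMeasurable (fun ω => ((X p.2 ω ^ k p.1 : Circle) : ℂ)) μ := fun p =>
    ((XYChain.continuous_coe_zpow _).measurable.comp (hXm p.2)).aestronglyMeasurable
  have hchar : ∀ ω, torusChar k (fun i => ∏ r ∈ B i, X r ω)
      = ∏ p : Σ i, B i, ((X p.2 ω ^ k p.1 : Circle) : ℂ) := fun ω => by
    rw [torusChar_apply_eq_prod, Fintype.prod_sigma]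
    refine Finset.prod_congr rfl fun i _ => ?_
    rw [Finset.prod_coe_sort (B i) fun r => ((X r ω ^ k i : Circle) : ℂ), ← Finset.prod_zpow]
    exact map_prod Circle.coeHom _ _
  simp_rw [hchar, hindep.integral_fun_prod_eq_prod_integral hmeas, Fintype.prod_sigma]
  exact Finset.prod_congr rfl fun i _ =>
    Finset.prod_coe_sort (B i) fun r => ∫ ω, ((X r ω ^ k i : Circle) : ℂ) ∂μ

theorem measureReal_lt_le_integral_pow_div [IsFiniteMeasure μ] {f : Ω → ℝ} (hf : ∀ ω, 0 ≤ f ω)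
    {p : ℕ} (hint : Integrable (fun ω => f ω ^ p) μ) {ε : ℝ} (hε : 0 < ε) :
    μ.real {ω | ε < f ω} ≤ (∫ ω, f ω ^ p ∂μ) / ε ^ p := by
  rw [le_div_iff₀ (by positivity), mul_comm]
  have hmarkov := mul_meas_ge_le_integral_of_nonneg (μ := μ) (f := fun ω => f ω ^ p)
    (Eventually.of_forall fun ω => pow_nonneg (hf ω) p) hint (ε ^ p)
  refine le_trans (mul_le_mul_of_nonneg_left (measureReal_mono fun ω hω => ?_) ?_) hmarkov
  · exact pow_le_pow_left₀ hε.le (le_of_lt hω) p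
  · positivity

theorem dist_circle_eq_norm (z w : Circle) : dist z w = ‖(z : ℂ) - w‖ :=
  dist_eq_norm (z : ℂ) w

instance : IsIsometricSMul Circle Circle :=
  ⟨fun c => Isometry.of_dist_eq fun x y => by
    rw [smul_eq_mul, smul_eq_mul, dist_circle_eq_norm, Circle.coe_mul, Circle.coe_mul, ← mul_sub,
      norm_mul, Circle.norm_coe, one_mul, dist_circle_eq_norm]⟩

theorem dist_one_sq (z : Circle) : dist z 1 ^ 2 = 2 - 2 * ((z ^ (1 : ℤ) : Circle) : ℂ).re := by
  have hnorm : (z : ℂ).re * (z : ℂ).re + (z : ℂ).im * (z : ℂ).im = 1 := by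
    rw [← Complex.normSq_apply, Circle.normSq_coe]
  rw [dist_circle_eq_norm, ← Complex.normSq_eq_norm_sq, Complex.normSq_apply]
  simp only [Circle.coe_one, Complex.sub_re, Complex.one_re, Complex.sub_im, Complex.one_im,
    sub_zero, zpow_one]
  linear_combination hnorm

theorem dist_one_pow_four (z : Circle) : dist z 1 ^ 4
    = 6 - 8 * ((z ^ (1 : ℤ) : Circle) : ℂ).re + 2 * ((z ^ (2 : ℤ) : Circle) : ℂ).re := by
  have hnorm : (z : ℂ).re * (z : ℂ).re + (z : ℂ).im * (z : ℂ).im = 1 := by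
    rw [← Complex.normSq_apply, Circle.normSq_coe]
  have hdouble : ((z ^ (2 : ℤ) : Circle) : ℂ).re
      = (z : ℂ).re * (z : ℂ).re - (z : ℂ).im * (z : ℂ).im := by
    rw [zpow_ofNat, pow_two, Circle.coe_mul, Complex.mul_re]
  rw [pow_mul (dist z 1) 2 2, dist_one_sq, hdouble, zpow_one]
  linear_combination 2 * hnorm

end CircleVariables

namespace XYChain

section VonMisesVariables

theorem integrable_coe_zpow {Ω : Type*} [MeasurableSpace Ω] {μ : Measure Ω} [IsFiniteMeasure μ]
    {Y : Ω → Circle} (hY : Measurable Y) (k : ℤ) :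
    Integrable (fun ω => ((Y ω ^ k : Circle) : ℂ)) μ :=
  Integrable.of_bound ((continuous_coe_zpow k).measurable.comp hY).aestronglyMeasurable 1
    (Eventually.of_forall fun _ => (Circle.norm_coe _).le)

theorem integrable_coe_zpow_re {Ω : Type*} [MeasurableSpace Ω] {μ : Measure Ω}
    [IsFiniteMeasure μ] {Y : Ω → Circle} (hY : Measurable Y) (k : ℤ) :
    Integrable (fun ω => ((Y ω ^ k : Circle) : ℂ).re) μ :=
  (integrable_coe_zpow hY k).re

theorem vonMisesCoeff_le_one (β : ℝ) (k : ℤ) : vonMisesCoeff β k ≤ 1 := by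
  have h := integral_mono (integrable_coe_zpow_re (μ := vonMises β) measurable_id k)
    (integrable_const 1) fun z => (Complex.re_le_norm _).trans (Circle.norm_coe (z ^ k)).le
  exact h.trans_eq (by simp)

variable {Ω : Type*} [MeasurableSpace Ω] {μ : Measure Ω} {β : ℝ} {κ : Type*} {X : κ → Ω → Circle}

theorem integral_prod_zpow_re (hX : iIndepFun X μ) (hXm : ∀ r, Measurable (X r))
    (hlaw : ∀ r, HasLaw (X r) (vonMises β) μ) (B : Finset κ) (k : ℤ) :
    ∫ ω, (((∏ r ∈ B, X r ω) ^ k : Circle) : ℂ).re ∂μ = vonMisesCoeff β k ^ B.card := by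
  have := hX.isProbabilityMeasure
  have hcoeff : ∀ r, ∫ ω, ((X r ω ^ k : Circle) : ℂ) ∂μ = vonMisesCoeff β k := fun r =>
    ((hlaw r).integral_comp (continuous_coe_zpow k).aestronglyMeasurable).trans
      (integral_zpow_vonMises β k)
  have hprod : ∫ ω, (((∏ r ∈ B, X r ω) ^ k : Circle) : ℂ) ∂μ = vonMisesCoeff β k ^ B.card := by
    have h := integral_torusChar_prod hX hXm (B := fun _ : Unit => B) Subsingleton.pairwise
      fun _ => k
    simpa only [torusChar_apply_eq_prod, Fintype.prod_unique, hcoeff, Finset.prod_const,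
      Finset.card_univ, Fintype.card_unit, pow_one] using h
  have hint := integrable_coe_zpow (μ := μ) (Finset.measurable_fun_prod B fun r _ => hXm r) k
  refine (integral_re hint).trans ?_
  rw [hprod, ← Complex.ofReal_pow]
  exact Complex.ofReal_re _

theorem measureReal_lt_dist_prod_le_sq (hX : iIndepFun X μ) (hXm : ∀ r, Measurable (X r))
    (hlaw : ∀ r, HasLaw (X r) (vonMises β) μ) (B : Finset κ) {ε : ℝ} (hε : 0 < ε) :
    μ.real {ω | ε < dist (∏ r ∈ B, X r ω) 1} ≤ (2 - 2 * vonMisesCoeff β 1 ^ B.card) / ε ^ 2 := by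
  have := hX.isProbabilityMeasure
  have hint := fun k => integrable_coe_zpow_re (μ := μ)
    (Finset.measurable_fun_prod B fun r _ => hXm r) k
  have hsq : ∀ ω, dist (∏ r ∈ B, X r ω) 1 ^ 2
      = 2 - 2 * (((∏ r ∈ B, X r ω) ^ (1 : ℤ) : Circle) : ℂ).re := fun ω => dist_one_sq _
  refine (measureReal_lt_le_integral_pow_div (p := 2) (fun _ => dist_nonneg) ?_ hε).trans_eq ?_
  · simp_rw [hsq]
    exact (integrable_const _).sub ((hint 1).const_mul 2)
  · simp_rw [hsq]
    rw [integral_sub (integrable_const _) ((hint 1).const_mul 2), integral_const_mul,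
      integral_prod_zpow_re hX hXm hlaw, integral_const, probReal_univ, one_smul]

theorem measureReal_lt_dist_prod_le_pow_four (hX : iIndepFun X μ) (hXm : ∀ r, Measurable (X r))
    (hlaw : ∀ r, HasLaw (X r) (vonMises β) μ) (B : Finset κ) {ε : ℝ} (hε : 0 < ε) :
    μ.real {ω | ε < dist (∏ r ∈ B, X r ω) 1}
      ≤ (6 - 8 * vonMisesCoeff β 1 ^ B.card + 2 * vonMisesCoeff β 2 ^ B.card) / ε ^ 4 := by
  have := hX.isProbabilityMeasure
  have hint := fun k => integrable_coe_zpow_re (μ := μ)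
    (Finset.measurable_fun_prod B fun r _ => hXm r) k
  have hsub : Integrable (fun ω => 6 - 8 * (((∏ r ∈ B, X r ω) ^ (1 : ℤ) : Circle) : ℂ).re) μ :=
    (integrable_const _).sub ((hint 1).const_mul 8)
  have hfour : ∀ ω, dist (∏ r ∈ B, X r ω) 1 ^ 4
      = 6 - 8 * (((∏ r ∈ B, X r ω) ^ (1 : ℤ) : Circle) : ℂ).re
        + 2 * (((∏ r ∈ B, X r ω) ^ (2 : ℤ) : Circle) : ℂ).re := fun ω => dist_one_pow_four _
  refine (measureReal_lt_le_integral_pow_div (p := 4) (fun _ => dist_nonneg) ?_ hε).trans_eq ?_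
  · simp_rw [hfour]
    exact hsub.add ((hint 2).const_mul 2)
  · simp_rw [hfour]
    rw [integral_add hsub ((hint 2).const_mul 2),
      integral_sub (integrable_const _) ((hint 1).const_mul 8), integral_const_mul,
      integral_const_mul, integral_prod_zpow_re hX hXm hlaw, integral_prod_zpow_re hX hXm hlaw,
      integral_const, probReal_univ, one_smul]

theorem measureReal_exists_lt_dist_prod_range_le {X : ℕ → Ω → Circle} (hX : iIndepFun X μ)
    (hXm : ∀ r, Measurable (X r)) (hlaw : ∀ r, HasLaw (X r) (vonMises β) μ) {ε : ℝ} (hε : 0 < ε)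
    (h_nonneg : 0 ≤ vonMisesCoeff β 1) {L : ℕ}
    (hL : (2 - 2 * vonMisesCoeff β 1 ^ L) / ε ^ 2 ≤ 1 / 2) :
    μ.real {ω | ∃ ℓ ≤ L, 2 * ε < dist (∏ r ∈ Finset.range ℓ, X r ω) 1}
      ≤ 2 * ((6 - 8 * vonMisesCoeff β 1 ^ L + 2 * vonMisesCoeff β 2 ^ L) / ε ^ 4) := by
  refine (ottaviani hX hXm fun ℓ _ => ?_).trans ?_
  · refine (measureReal_lt_dist_prod_le_sq hX hXm hlaw _ hε).trans (le_trans ?_ hL)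
    rw [Nat.card_Ico]
    gcongr ?_ / _
    linarith [pow_le_pow_of_le_one h_nonneg (vonMisesCoeff_le_one β 1) (Nat.sub_le L ℓ)]
  · have h := measureReal_lt_dist_prod_le_pow_four hX hXm hlaw (Finset.range L) hε
    rw [Finset.card_range] at h
    linarith

end VonMisesVariables

section Oscillation

theorem floor_block_bounds {n m : ℕ} (hm : 0 < m) {t : ℝ} (ht : 0 ≤ t) :
    n * ⌊(m : ℝ) * t⌋₊ / m ≤ ⌊(n : ℝ) * t⌋₊ ∧
      ⌊(n : ℝ) * t⌋₊ ≤ n * ⌊(m : ℝ) * t⌋₊ / m + (n / m + 1) := by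
  have hm' : (0 : ℝ) < m := by exact_mod_cast hm
  have hj : (⌊(m : ℝ) * t⌋₊ : ℝ) ≤ m * t := Nat.floor_le (by positivity)
  have hj' : (m : ℝ) * t < ⌊(m : ℝ) * t⌋₊ + 1 := Nat.lt_floor_add_one _
  have hk : (⌊(n : ℝ) * t⌋₊ : ℝ) ≤ n * t := Nat.floor_le (by positivity)
  generalize ⌊(m : ℝ) * t⌋₊ = j at *
  constructor
  · refine Nat.le_floor (Nat.cast_div_le.trans ?_)
    rw [div_le_iff₀ hm']
    push_cast
    nlinarith [mul_le_mul_of_nonneg_left hj n.cast_nonneg (α := ℝ)]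
  · generalize ⌊(n : ℝ) * t⌋₊ = k at *
    have hkj : k * m ≤ n * (j + 1) := by
      have : (k : ℝ) * m ≤ n * (j + 1) := by
        nlinarith [mul_le_mul_of_nonneg_right hk hm'.le,
          mul_le_mul_of_nonneg_left hj'.le n.cast_nonneg (α := ℝ)]
      exact_mod_cast this
    have hlt : k * m < (n * j / m + (n / m + 2)) * m := by
      nlinarith [Nat.div_add_mod (n * j) m, Nat.div_add_mod n m, Nat.mod_lt (n * j) hm,
        Nat.mod_lt n hm]
    have := Nat.lt_of_mul_lt_mul_right hlt
    omega

theorem dist_walk_add (ξ : ℕ → Circle) (s ℓ : ℕ) :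
    dist (walk ξ (s + ℓ)) (walk ξ s) = dist (∏ r ∈ Finset.range ℓ, ξ (s + 1 + r)) 1 := by
  rw [walk, walk, add_right_comm, Finset.prod_range_add]
  simpa using dist_mul_left (∏ i ∈ Finset.range (s + 1), ξ i)
    (∏ r ∈ Finset.range ℓ, ξ (s + 1 + r)) 1

theorem iIndepFun_steps (β : ℝ) : iIndepFun (fun r (ξ : ℕ → Circle) => ξ r) (steps β) :=
  iIndepFun_infinitePi (X := fun _ z => z) fun _ => measurable_id

theorem hasLaw_steps (β : ℝ) (r : ℕ) :
    HasLaw (fun ξ : ℕ → Circle => ξ r) (vonMises (if r = 0 then 0 else β)) (steps β) where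
  aemeasurable := (measurable_pi_apply r).aemeasurable
  map_eq := Measure.infinitePi_map_eval _ r

theorem measureReal_exists_lt_dist_walk_le {β ε : ℝ} (hε : 0 < ε)
    (h_nonneg : 0 ≤ vonMisesCoeff β 1) {L : ℕ}
    (hL : (2 - 2 * vonMisesCoeff β 1 ^ L) / ε ^ 2 ≤ 1 / 2) (s : ℕ) :
    (steps β).real {ξ | ∃ ℓ ≤ L, 2 * ε < dist (walk ξ (s + ℓ)) (walk ξ s)}
      ≤ 2 * ((6 - 8 * vonMisesCoeff β 1 ^ L + 2 * vonMisesCoeff β 2 ^ L) / ε ^ 4) := by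
  have hlaw : ∀ r, HasLaw (fun ξ : ℕ → Circle => ξ (s + 1 + r)) (vonMises β) (steps β) :=
      fun r => by
    simpa only [if_neg (show s + 1 + r ≠ 0 by lia)] using hasLaw_steps β (s + 1 + r)
  have hindep : iIndepFun (fun r (ξ : ℕ → Circle) => ξ (s + 1 + r)) (steps β) :=
    (iIndepFun_steps β).precomp (add_right_injective (s + 1))
  simp_rw [dist_walk_add]
  exact measureReal_exists_lt_dist_prod_range_le hindep (fun r => measurable_pi_apply _) hlaw hε
    h_nonneg hL

/-- The event that the path of the walk on the chain of length `n` moves by more than `2 * ε` away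
from its value at the last of the `m + 1` coarse sites `n * j / m`. -/
def oscillates (n m : ℕ) (ε : ℝ) : Set (ℕ → Circle) :=
  {ξ | ∃ t : I, 2 * ε < dist (walk ξ (site n t)) (walk ξ (n * (site m t) / m))}

theorem measureReal_oscillates_le {β ε : ℝ} {n m : ℕ} (hm : 0 < m) (hε : 0 < ε)
    (h_nonneg : 0 ≤ vonMisesCoeff β 1)
    (hL : (2 - 2 * vonMisesCoeff β 1 ^ (n / m + 1)) / ε ^ 2 ≤ 1 / 2) :
    (steps β).real (oscillates n m ε) ≤ (m + 1) * (2 * ((6 - 8 * vonMisesCoeff β 1 ^ (n / m + 1)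
      + 2 * vonMisesCoeff β 2 ^ (n / m + 1)) / ε ^ 4)) := by
  have hsub : oscillates n m ε ⊆ ⋃ j ∈ Finset.range (m + 1),
      {ξ | ∃ ℓ ≤ n / m + 1, 2 * ε < dist (walk ξ (n * j / m + ℓ)) (walk ξ (n * j / m))} := by
    rintro ξ ⟨t, ht⟩
    obtain ⟨hle, hle_add⟩ := floor_block_bounds (n := n) hm t.2.1
    refine mem_biUnion (x := (site m t : ℕ)) (Finset.mem_range.2 (site m t).2)
      ⟨site n t - n * (site m t) / m, Nat.sub_le_iff_le_add'.2 hle_add, ?_⟩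
    rwa [Nat.add_sub_cancel' (show n * (site m t : ℕ) / m ≤ site n t from hle)]
  calc (steps β).real (oscillates n m ε) ≤ _ := measureReal_mono hsub (measure_ne_top _ _)
    _ ≤ _ := measureReal_biUnion_finset_le _ _
    _ ≤ ∑ _j ∈ Finset.range (m + 1), 2 * ((6 - 8 * vonMisesCoeff β 1 ^ (n / m + 1)
          + 2 * vonMisesCoeff β 2 ^ (n / m + 1)) / ε ^ 4) :=
        Finset.sum_le_sum fun j _ => measureReal_exists_lt_dist_walk_le hε h_nonneg hL (n * j / m)
    _ = _ := by simp

theorem tendsto_mul_div_div (j : ℕ) {m : ℕ} (hm : 0 < m) :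
    Tendsto (fun n : ℕ => ((n * j / m : ℕ) : ℝ) / n) atTop (𝓝 (j / m)) := by
  have h := (tendsto_nat_floor_mul_div_atTop (R := ℝ) (a := (j : ℝ) / m) (by positivity)).comp
    tendsto_natCast_atTop_atTop
  refine h.congr fun n => ?_
  rw [Function.comp_apply, ← Nat.floor_div_eq_div (K := ℝ), Nat.cast_mul, mul_comm (n : ℝ),
    div_mul_eq_mul_div]

theorem exp_combination_le {u : ℝ} (hu : 0 ≤ u) :
    6 - 8 * Real.exp (-u) + 2 * Real.exp (-(4 * u)) ≤ 12 * u ^ 2 := by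
  have hpow : Real.exp (-(4 * u)) = Real.exp (-u) ^ 4 := by
    rw [← Real.exp_nat_mul]; congr 1; push_cast; ring
  have hone_sub : 1 - Real.exp (-u) ≤ u := by linarith [Real.add_one_le_exp (-u)]
  have hle_one : Real.exp (-u) ≤ 1 := Real.exp_le_one_iff.2 (by linarith)
  have hpos : 0 < Real.exp (-u) := Real.exp_pos _
  rw [hpow]
  generalize Real.exp (-u) = q at *
  calc 6 - 8 * q + 2 * q ^ 4 = 2 * (1 - q) ^ 2 * (q ^ 2 + 2 * q + 3) := by ring
    _ ≤ 2 * (1 - q) ^ 2 * 6 := by gcongr; nlinarith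
    _ ≤ 2 * u ^ 2 * 6 := by gcongr
    _ = _ := by ring

variable {β : ℕ → ℝ} {b : ℝ}

theorem tendsto_vonMisesCoeff_pow_div_add_one (hb : 0 < b)
    (hβ : Tendsto (fun n : ℕ => β n / (n : ℝ)) atTop (𝓝 b)) (k : ℤ) {m : ℕ} (hm : 0 < m) :
    Tendsto (fun n => vonMisesCoeff (β n) k ^ (n / m + 1)) atTop
      (𝓝 (Real.exp (-(k ^ 2 * (1 / (2 * b) / m))))) := by
  have hℓ : Tendsto (fun n : ℕ => ((n / m + 1 : ℕ) : ℝ) / n) atTop (𝓝 (1 / m)) := by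
    have h := (tendsto_mul_div_div 1 hm).add (tendsto_one_div_atTop_nhds_zero_nat (𝕜 := ℝ))
    simpa [add_div] using h
  convert tendsto_vonMisesCoeff_pow hb hβ k hℓ using 4
  field_simp

theorem tendsto_vonMisesCoeff (hb : 0 < b)
    (hβ : Tendsto (fun n : ℕ => β n / (n : ℝ)) atTop (𝓝 b)) (k : ℤ) :
    Tendsto (fun n => vonMisesCoeff (β n) k) atTop (𝓝 1) := by
  have h := tendsto_vonMisesCoeff_pow hb hβ k (ℓ := fun _ => 1) (τ := 0)
    (by simpa using tendsto_one_div_atTop_nhds_zero_nat (𝕜 := ℝ))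
  simpa using h

theorem eventually_measureReal_oscillates_lt_of_lt (hb : 0 < b)
    (hβ : Tendsto (fun n : ℕ => β n / (n : ℝ)) atTop (𝓝 b)) {ε δ : ℝ} (hε : 0 < ε) {m : ℕ}
    (hm : 0 < m) (hhalf : 2 * (1 / (2 * b) / m) / ε ^ 2 < 1 / 2)
    (hδ : (m + 1) * (1 / (2 * b) / m) * (24 * (1 / (2 * b) / m) / ε ^ 4) < δ) :
    ∀ᶠ n : ℕ in atTop, (steps (β n)).real (oscillates n m ε) < δ := by
  have hu : 0 ≤ 1 / (2 * b) / m := by positivity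
  have hcoeff₁ := tendsto_vonMisesCoeff_pow_div_add_one hb hβ 1 hm
  have hcoeff₂ := tendsto_vonMisesCoeff_pow_div_add_one hb hβ 2 hm
  norm_num only [Int.cast_one, Int.cast_ofNat, one_mul, one_pow] at hcoeff₁ hcoeff₂
  generalize 1 / (2 * b) / m = u at *
  have hsq := ((hcoeff₁.const_mul 2).const_sub 2).div_const (ε ^ 2)
  have hsq_lt : (2 - 2 * Real.exp (-u)) / ε ^ 2 < 1 / 2 := by
    refine lt_of_le_of_lt ?_ hhalf
    gcongr
    linarith [Real.add_one_le_exp (-u)]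
  have hfour := (((((hcoeff₁.const_mul 8).const_sub 6).add (hcoeff₂.const_mul 2)).div_const
    (ε ^ 4)).const_mul 2).const_mul ((m : ℝ) + 1)
  have hfour_lt : ((m : ℝ) + 1) * (2 * ((6 - 8 * Real.exp (-u) + 2 * Real.exp (-(4 * u))) / ε ^ 4))
      < δ := by
    refine lt_of_le_of_lt ?_ hδ
    calc _ ≤ ((m : ℝ) + 1) * (2 * (12 * u ^ 2 / ε ^ 4)) := by
          gcongr; exact exp_combination_le hu
      _ = _ := by ring
  filter_upwards [hsq.eventually_lt_const hsq_lt, hfour.eventually_lt_const hfour_lt,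
    (tendsto_vonMisesCoeff hb hβ 1).eventually_const_lt one_pos] with n hn_sq hn_four hn_pos
  exact (measureReal_oscillates_le hm hε hn_pos.le hn_sq.le).trans_lt hn_four

theorem eventually_measureReal_oscillates_lt (hb : 0 < b)
    (hβ : Tendsto (fun n : ℕ => β n / (n : ℝ)) atTop (𝓝 b)) {ε δ : ℝ} (hε : 0 < ε) (hδ : 0 < δ) :
    ∀ᶠ m : ℕ in atTop, ∀ᶠ n : ℕ in atTop, (steps (β n)).real (oscillates n m ε) < δ := by
  have hu : Tendsto (fun m : ℕ => 1 / (2 * b) / (m : ℝ)) atTop (𝓝 0) :=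
    tendsto_const_div_atTop_nhds_zero_nat _
  have hmu : Tendsto (fun m : ℕ => ((m : ℝ) + 1) * (1 / (2 * b) / m)) atTop (𝓝 (1 / (2 * b))) := by
    have h := hu.const_add (1 / (2 * b))
    rw [add_zero] at h
    refine h.congr' ?_
    filter_upwards [eventually_ne_atTop 0] with m hm
    field_simp
  have hbound := hmu.mul ((hu.const_mul 24).div_const (ε ^ 4))
  have hhalf := (hu.const_mul 2).div_const (ε ^ 2)
  rw [mul_zero, zero_div] at hhalf
  rw [mul_zero, zero_div, mul_zero] at hbound
  filter_upwards [hbound.eventually_lt_const hδ, hhalf.eventually_lt_const one_half_pos,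
    eventually_gt_atTop 0] with m hm_bound hm_half hm
  exact eventually_measureReal_oscillates_lt_of_lt hb hβ hε hm hm_half hm_bound

end Oscillation

end XYChain

theorem nhdsWithin_inter_Ici_neBot {α : Type*} [LinearOrder α] [OrderTop α] [DenselyOrdered α]
    [TopologicalSpace α] [OrderTopology α] {D : Set α} (hD : Dense D) (hD_top : ⊤ ∈ D) (t : α) :
    (𝓝[D ∩ Ici t] t).NeBot := by
  rw [← mem_closure_iff_nhdsWithin_neBot]
  rcases eq_or_lt_of_le (le_top : t ≤ ⊤) with rfl | ht
  · exact subset_closure ⟨hD_top, self_mem_Ici⟩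
  · have hIoi : Ioi t ⊆ closure (D ∩ Ici t) :=
      (hD.open_subset_closure_inter isOpen_Ioi).trans
        (closure_mono fun s hs => ⟨hs.2, le_of_lt hs.1⟩)
    refine closure_minimal hIoi isClosed_closure ?_
    rw [closure_Ioi' ⟨⊤, ht⟩]
    exact self_mem_Ici

theorem measurableSet_uniformContinuousOn {T E : Type*} [PseudoMetricSpace T] [PseudoMetricSpace E]
    [SecondCountableTopology E] [MeasurableSpace E] [OpensMeasurableSpace E] {D : Set T}
    (hD : D.Countable) : MeasurableSet {z : T → E | UniformContinuousOn z D} := by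
  simp only [Metric.uniformity_basis_dist_inv_nat_succ.uniformContinuousOn_iff
    Metric.uniformity_basis_dist_inv_nat_succ, true_imp_iff, true_and, mem_ofPred_eq,
    ofPred_forall, ofPred_exists]
  refine .iInter fun _ => .iUnion fun _ => .biInter hD fun s _ => .biInter hD fun t _ =>
    .iInter fun _ => ?_
  exact measurableSet_lt ((measurable_pi_apply s).dist (measurable_pi_apply t)) measurable_const

namespace CadlagPath

variable {E : Type*}

theorem edist_le_of_forall_edist_le [PseudoEMetricSpace E] {x y : CadlagPath E}
    {c : ℝ≥0∞} (h : ∀ t, edist (x t) (y t) ≤ c) : edist x y ≤ c :=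
  (iInf_le _ (OrderIso.refl I)).trans (max_le (by simp) (iSup_le fun t => by simpa using h t))

theorem continuous_of_uniformContinuousOn [PseudoMetricSpace E] (x : CadlagPath E) {D : Set I}
    (hD : Dense D) (hD_top : ⊤ ∈ D) (hx : UniformContinuousOn x.toFun D) : Continuous x.toFun := by
  refine UniformContinuous.continuous (Metric.uniformContinuous_iff_le.2 fun ε hε => ?_)
  obtain ⟨δ, hδ, h⟩ := Metric.uniformContinuousOn_iff.1 hx ε hε
  refine ⟨δ / 2, half_pos hδ, fun s t hst => ?_⟩
  have := nhdsWithin_inter_Ici_neBot hD hD_top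
  have hlim : ∀ t : I, Tendsto x.toFun (𝓝[D ∩ Ici t] t) (𝓝 (x t)) := fun t =>
    (x.right_continuous t).mono inter_subset_right
  have hid : ∀ t : I, Tendsto id (𝓝[D ∩ Ici t] t) (𝓝 t) := fun t => nhdsWithin_le_nhds
  have hdist := ((hid s).comp tendsto_fst).dist ((hid t).comp
    (tendsto_snd (f := 𝓝[D ∩ Ici s] s)))
  refine le_of_tendsto (((hlim s).comp tendsto_fst).dist ((hlim t).comp tendsto_snd)) ?_
  filter_upwards [hdist.eventually_lt_const (hst.trans_lt (half_lt_self hδ)),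
    prod_mem_prod self_mem_nhdsWithin self_mem_nhdsWithin] with p hp hpD
  exact (h p.1 hpD.1.1 p.2 hpD.2.1 hp).le

end CadlagPath

namespace XYChain

theorem lipschitzWith_spinPath (m : ℕ) : LipschitzWith 1 (spinPath m) :=
  LipschitzWith.of_edist_le fun x y => CadlagPath.edist_le_of_forall_edist_le fun t =>
    edist_le_pi_edist x y (site m t)

/-- The position `j / m` of the vertex `j` in the unit interval. -/
def gridPoint (m : ℕ) (j : Fin (m + 1)) : I :=
  ⟨(j : ℕ) / m, by positivity,
    div_le_one_of_le₀ (by exact_mod_cast Nat.lt_succ_iff.1 j.2) (by positivity)⟩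

theorem dist_gridPoint_site_le {m : ℕ} (hm : 0 < m) (t : I) :
    dist (gridPoint m (site m t)) t ≤ 1 / m := by
  have hm' : (0 : ℝ) < m := by exact_mod_cast hm
  have h_floor_le : (⌊(m : ℝ) * t⌋₊ : ℝ) ≤ m * t := Nat.floor_le (mul_nonneg hm'.le t.2.1)
  have h_lt_floor : (m : ℝ) * t < ⌊(m : ℝ) * t⌋₊ + 1 := Nat.lt_floor_add_one _
  have hsub : ((gridPoint m (site m t) : I) : ℝ) - t = (⌊(m : ℝ) * t⌋₊ - m * t) / m := by
    simp only [gridPoint, site]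
    field_simp
  rw [Subtype.dist_eq, Real.dist_eq, hsub, abs_div, abs_of_pos hm']
  gcongr
  rw [abs_le]
  constructor <;> linarith

theorem tendsto_spinPath_gridPoint {x : CadlagPath Circle} (hx : Continuous x.toFun) :
    Tendsto (fun m => spinPath m fun j => x (gridPoint m j)) atTop (𝓝 x) := by
  rw [EMetric.tendsto_nhds]
  intro ε hε
  obtain ⟨ε', hε', hlt⟩ := exists_between hε
  obtain ⟨δ, hδ, h⟩ := EMetric.uniformContinuous_iff.1
    (CompactSpace.uniformContinuous_of_continuous hx) ε' hε'
  have hmesh : Tendsto (fun m : ℕ => ENNReal.ofReal (1 / m)) atTop (𝓝 0) := by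
    simpa using ENNReal.tendsto_ofReal (tendsto_one_div_atTop_nhds_zero_nat (𝕜 := ℝ))
  filter_upwards [hmesh.eventually_lt_const hδ, eventually_gt_atTop 0] with m hm hm_pos
  refine lt_of_le_of_lt (CadlagPath.edist_le_of_forall_edist_le fun t => (h ?_).le) hlt
  rw [edist_dist]
  exact (ENNReal.ofReal_le_ofReal (dist_gridPoint_site_le hm_pos t)).trans_lt hm

end XYChain
theorem ae_uniformContinuousOn_of_identDistrib {Ω Ω' T E : Type*} [MeasurableSpace Ω]
    [MeasurableSpace Ω'] {P : Measure Ω} {P' : Measure Ω'} [PseudoMetricSpace T] [CompactSpace T]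
    [PseudoMetricSpace E] [SecondCountableTopology E] [MeasurableSpace E]
    [OpensMeasurableSpace E] {Z : Ω' → T → E} {W : Ω → T → E} (hZW : IdentDistrib Z W P' P)
    (hW : ∀ᵐ ω ∂P, Continuous (W ω)) {D : Set T} (hD : D.Countable) :
    ∀ᵐ ω ∂P', UniformContinuousOn (Z ω) D :=
  hZW.symm.ae_mem_snd (measurableSet_uniformContinuousOn hD) <| hW.mono fun _ h =>
    (CompactSpace.uniformContinuous_of_continuous h).uniformContinuousOn

namespace CadlagPath

theorem ae_continuous_of_ae_eq_mul {Ω Ω' G : Type*} [MeasurableSpace Ω] [MeasurableSpace Ω']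
    {P : Measure Ω} {P' : Measure Ω'} [PseudoMetricSpace G] [Mul G] [IsIsometricSMul G G]
    [SecondCountableTopology G] [MeasurableSpace G] [OpensMeasurableSpace G]
    {x : Ω' → CadlagPath G} {U : Ω' → G} {Z : Ω' → I → G} {W : Ω → I → G}
    (hx : ∀ᵐ ω ∂P', ∀ t, x ω t = U ω * Z ω t) (hZW : IdentDistrib Z W P' P)
    (hW : ∀ᵐ ω ∂P, Continuous (W ω)) : ∀ᵐ ω ∂P', Continuous (x ω).toFun := by
  obtain ⟨D, hD_countable, hD, -, hD_top⟩ := exists_countable_dense_bot_top I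
  filter_upwards [hx, ae_uniformContinuousOn_of_identDistrib hZW hW hD_countable] with ω hω hZω
  refine (x ω).continuous_of_uniformContinuousOn hD (hD_top ⊤ isTop_top) ?_
  rw [show (x ω).toFun = (U ω * ·) ∘ Z ω from funext hω]
  exact (isometry_mul_left (U ω)).uniformContinuous.comp_uniformContinuousOn hZω

end CadlagPath

namespace XYChain

section Brownian

theorem integral_exp_zpow_gaussianReal (c : ℝ) (k : ℤ) (v : NNReal) :
    ∫ x, ((Circle.exp (x / c) ^ k : Circle) : ℂ) ∂gaussianReal 0 v
      = Real.exp (-(k ^ 2 * v / (2 * c ^ 2))) := by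
  have hexp : ∀ x : ℝ, ((Circle.exp (x / c) ^ k : Circle) : ℂ)
      = Complex.exp (((k / c : ℝ) : ℂ) * x * Complex.I) := fun x => by
    rw [← Circle.exp_zsmul, Circle.coe_exp, zsmul_eq_mul]
    push_cast; ring_nf
  simp_rw [hexp, ← charFun_apply_real, charFun_gaussianReal]
  push_cast
  congr 1
  ring

/-- The increments of a function on `[0,1]` between neighbouring points of the grid of mesh
`1 / m`. -/
def gridIncrement (m : ℕ) (z : I → Circle) (i : Fin m) : Circle :=
  z (gridPoint m i.succ) / z (gridPoint m i.castSucc)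

theorem measurable_gridIncrement (m : ℕ) : Measurable (gridIncrement m) :=
  measurable_pi_iff.2 fun _ => (measurable_pi_apply _).div (measurable_pi_apply _)

theorem gridPoint_succ_sub_castSucc (m : ℕ) (i : Fin m) :
    (gridPoint m i.succ : ℝ) - gridPoint m i.castSucc = 1 / m := by
  simp only [gridPoint, Fin.val_succ, Fin.val_castSucc]
  push_cast; ring

theorem monotone_gridPoint (m : ℕ) : Monotone (gridPoint m) := fun i j hij =>
  show (i : ℝ) / m ≤ j / m by gcongr; exact hij

variable {Ω : Type*} {B : NNReal → Ω → ℝ}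

/-- The path `t ↦ exp (i B(t) / c)`, `t ∈ [0,1]`, on the circle. -/
def wrappedPath (B : NNReal → Ω → ℝ) (c : ℝ) (ω : Ω) (t : I) : Circle :=
  Circle.exp (B (unitInterval.toNNReal t) ω / c)

theorem gridIncrement_wrappedPath (c : ℝ) (m : ℕ) (ω : Ω) (i : Fin m) :
    gridIncrement m (wrappedPath B c ω) i
      = Circle.exp ((B (unitInterval.toNNReal (gridPoint m i.succ)) ω
        - B (unitInterval.toNNReal (gridPoint m i.castSucc)) ω) / c) := by
  rw [sub_div, Circle.exp_sub]
  rfl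

variable [MeasurableSpace Ω] {P : Measure Ω}

theorem ae_continuous_wrappedPath (hB : IsBrownianReal B P) (c : ℝ) :
    ∀ᵐ ω ∂P, Continuous (wrappedPath B c ω) := by
  filter_upwards [hB.cont] with ω hω
  exact Circle.exp.continuous.comp ((hω.comp unitInterval.toNNReal_continuous).div_const c)

theorem measurable_exp_div_zpow (c : ℝ) (k : ℤ) :
    Measurable fun x : ℝ => ((Circle.exp (x / c) ^ k : Circle) : ℂ) :=
  ((continuous_coe_zpow k).comp (by fun_prop)).measurable

theorem integral_gridIncrement_wrappedPath_zpow (hB : IsPreBrownianReal B P) (c : ℝ) {m : ℕ}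
    (i : Fin m) (k : ℤ) :
    ∫ ω, ((gridIncrement m (wrappedPath B c ω) i ^ k : Circle) : ℂ) ∂P
      = Real.exp (-(k ^ 2 * (1 / m) / (2 * c ^ 2))) := by
  have hdist : dist (gridPoint m i.succ) (gridPoint m i.castSucc) = 1 / m := by
    rw [Subtype.dist_eq, Real.dist_eq, gridPoint_succ_sub_castSucc, abs_of_nonneg (by positivity)]
  simp only [gridIncrement_wrappedPath]
  refine ((hB.hasLaw_sub _ _).integral_comp
    (measurable_exp_div_zpow c k).aestronglyMeasurable).trans ?_
  rw [integral_exp_zpow_gaussianReal, ← hdist]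
  rfl

theorem integral_torusChar_gridIncrement_wrappedPath (hB : IsPreBrownianReal B P) (c : ℝ) {m : ℕ}
    (k : Fin m → ℤ) : ∫ ω, torusChar k (gridIncrement m (wrappedPath B c ω)) ∂P
      = ((∏ i, Real.exp (-(k i ^ 2 * (1 / m) / (2 * c ^ 2))) : ℝ) : ℂ) := by
  have hindep := (hB.hasIndepIncrements m (fun j => unitInterval.toNNReal (gridPoint m j))
    fun _ _ h => monotone_gridPoint m h).comp _ fun i => measurable_exp_div_zpow c (k i)
  have hmeas := fun i : Fin m => ((measurable_exp_div_zpow c (k i)).comp_aemeasurable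
    ((hB.aemeasurable (unitInterval.toNNReal (gridPoint m i.succ))).sub
      (hB.aemeasurable (unitInterval.toNNReal (gridPoint m i.castSucc))))).aestronglyMeasurable
  calc ∫ ω, torusChar k (gridIncrement m (wrappedPath B c ω)) ∂P
      = ∫ ω, ∏ i, ((gridIncrement m (wrappedPath B c ω) i ^ k i : Circle) : ℂ) ∂P := by
        simp only [torusChar_apply_eq_prod]
    _ = ∏ i, ∫ ω, ((gridIncrement m (wrappedPath B c ω) i ^ k i : Circle) : ℂ) ∂P := by
        simp only [gridIncrement_wrappedPath]
        exact hindep.integral_fun_prod_eq_prod_integral hmeas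
    _ = _ := by simp only [integral_gridIncrement_wrappedPath_zpow hB, Complex.ofReal_prod]

end Brownian

theorem hasLaw_exp_of_isUniform {Ω : Type*} [MeasurableSpace Ω] {P : Measure Ω} {X : Ω → ℝ}
    (hX : pdf.IsUniform X (Ico (-Real.pi) Real.pi) P volume) :
    HasLaw (fun ω => Circle.exp (X ω)) (vonMises 0) P := by
  have hXm : AEMeasurable X P := hX.aemeasurable (by simp [Real.pi_pos]) (by simp)
  have hexp : Measurable Circle.exp := Circle.exp.continuous.measurable
  refine ⟨hexp.comp_aemeasurable hXm, ?_⟩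
  calc P.map (fun ω => Circle.exp (X ω)) = (P.map X).map Circle.exp :=
        (AEMeasurable.map_map_of_aemeasurable hexp.aemeasurable hXm).symm
    _ = (arcLength univ)⁻¹ • arcLength := by
        rw [hX, ProbabilityTheory.cond, Measure.map_smul,
          Measure.restrict_congr_set Ico_ae_eq_Ioc, arcLength,
          Measure.map_apply hexp MeasurableSet.univ]
        simp
    _ = vonMises 0 := by simp [vonMises]

section Blocks

/-- The step `0` followed by the blocks of steps leading from one coarse site `n * i / m` to the
next. -/
def blocks (n m : ℕ) : Fin (m + 1) → Finset ℕ :=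
  Fin.cons {0} fun i : Fin m => Finset.Ioc (n * i / m) (n * (i + 1) / m)

theorem mul_div_le_mul_div (n m : ℕ) {i j : ℕ} (h : i ≤ j) : n * i / m ≤ n * j / m :=
  Nat.div_le_div_right (Nat.mul_le_mul_left n h)

theorem pairwise_disjoint_blocks (n m : ℕ) : Pairwise (Function.onFun Disjoint (blocks n m)) := by
  refine (Std.Symm.pairwise_on _).2 fun i j hij => Finset.disjoint_left.2 fun r hi hj => ?_
  obtain ⟨j, rfl⟩ := Fin.exists_succ_eq.2 (Fin.ne_zero_of_lt hij)
  simp only [blocks, Fin.cons_succ, Finset.mem_Ioc] at hj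
  cases i using Fin.cases with
  | zero =>
    simp only [blocks, Fin.cons_zero, Finset.mem_singleton] at hi
    exact absurd hj.1 (hi ▸ Nat.not_lt_zero _)
  | succ i =>
    simp only [blocks, Fin.cons_succ, Finset.mem_Ioc] at hi
    exact absurd (hi.2.trans (mul_div_le_mul_div n m (Fin.succ_lt_succ_iff.1 hij)))
      (not_le.2 hj.1)

theorem walk_eq_cumProd_blocks (n m : ℕ) (ξ : ℕ → Circle) :
    cumProd (m + 1) (fun i => ∏ r ∈ blocks n m i, ξ r)
      = fun j : Fin (m + 1) => walk ξ (n * j / m) := by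
  refine cumProd_eq_of_succ (by simp [blocks, walk]) fun i => ?_
  have hle := Nat.succ_le_succ (mul_div_le_mul_div n m (Nat.le_succ (i : ℕ)))
  simp only [blocks, Fin.cons_succ, Fin.val_succ, Fin.val_castSucc, walk]
  rw [mul_comm, ← Finset.Ico_add_one_add_one_eq_Ioc]
  exact Finset.prod_range_mul_prod_Ico _ hle

theorem integral_torusChar_blocks (β : ℝ) (n m : ℕ) (k : Fin (m + 1) → ℤ) :
    ∫ ξ, torusChar k (fun i => ∏ r ∈ blocks n m i, ξ r) ∂(steps β)
      = ((vonMisesCoeff 0 (k 0)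
        * ∏ i : Fin m, vonMisesCoeff β (k i.succ) ^ (n * (i + 1) / m - n * i / m) : ℝ) : ℂ) := by
  have hstep : ∀ (r : ℕ) (k : ℤ), ∫ ξ, ((ξ r ^ k : Circle) : ℂ) ∂steps β
      = vonMisesCoeff (if r = 0 then 0 else β) k := fun r k => by
    rw [← integral_zpow_vonMises]
    exact (hasLaw_steps β r).integral_comp (continuous_coe_zpow k).aestronglyMeasurable
  have hpow : ∀ i : Fin m, ∏ r ∈ Finset.Ioc (n * i / m) (n * (i + 1) / m),
      (vonMisesCoeff (if r = 0 then 0 else β) (k i.succ) : ℂ)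
        = (vonMisesCoeff β (k i.succ) : ℂ) ^ (n * (i + 1) / m - n * i / m) := fun i => by
    rw [← Nat.card_Ioc, ← Finset.prod_const]
    refine Finset.prod_congr rfl fun r hr => ?_
    rw [if_neg (Nat.ne_zero_of_lt (Finset.mem_Ioc.1 hr).1)]
  rw [integral_torusChar_prod (iIndepFun_steps β) measurable_pi_apply
    (pairwise_disjoint_blocks n m), Fin.prod_univ_succ]
  simp only [hstep, blocks, Fin.cons_zero, Fin.cons_succ, hpow, Finset.prod_singleton, if_true]
  push_cast
  rfl

theorem tendsto_card_block_div {m : ℕ} (hm : 0 < m) (i : ℕ) :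
    Tendsto (fun n : ℕ => ((n * (i + 1) / m - n * i / m : ℕ) : ℝ) / n) atTop (𝓝 (1 / m)) := by
  have h := (tendsto_mul_div_div (i + 1) hm).sub (tendsto_mul_div_div i hm)
  rw [show ((i + 1 : ℕ) : ℝ) / m - i / m = 1 / m by push_cast; ring] at h
  refine h.congr fun n => ?_
  rw [Nat.cast_sub (mul_div_le_mul_div n m (Nat.le_succ i)), sub_div]

theorem edist_spinPath_walk_le {n m : ℕ} {ε : ℝ} {ξ : ℕ → Circle} (hξ : ξ ∉ oscillates n m ε) :
    edist (spinPath n fun j => walk ξ j) (spinPath m fun j => walk ξ (n * j / m))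
      ≤ ENNReal.ofReal (2 * ε) := by
  refine CadlagPath.edist_le_of_forall_edist_le fun t => ?_
  rw [edist_dist]
  exact ENNReal.ofReal_le_ofReal (not_lt.1 fun h => hξ ⟨t, h⟩)

end Blocks

section Limit

/-- The starting point `u` and the grid increments of the path `t ↦ u * z t`: the continuum analogue
of the products of the steps of a walk over `blocks`. -/
def pathBlocks (m : ℕ) (u : Circle) (z : I → Circle) : Fin (m + 1) → Circle :=
  Fin.cons u (gridIncrement m z)

theorem cumProd_pathBlocks (m : ℕ) (u : Circle) {z : I → Circle} (hz : z 0 = 1) :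
    cumProd (m + 1) (pathBlocks m u z) = fun j => u * z (gridPoint m j) := by
  refine cumProd_eq_of_succ ?_ fun i => ?_
  · have : gridPoint m 0 = 0 := Subtype.ext (by simp [gridPoint])
    simp [pathBlocks, this, hz]
  · simp only [pathBlocks, Fin.cons_succ, gridIncrement]
    rw [mul_left_comm, div_mul_cancel]

variable {Ω : Type*} [MeasurableSpace Ω] {P : Measure Ω} {B : NNReal → Ω → ℝ} {β : ℕ → ℝ} {b c : ℝ}
  {Ω' : Type*} [MeasurableSpace Ω'] {P' : Measure Ω'} {U : Ω' → Circle} {Z : Ω' → I → Circle}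

theorem aemeasurable_pathBlocks (hU : AEMeasurable U P') (hZ : AEMeasurable Z P') (m : ℕ) :
    AEMeasurable (fun ω => pathBlocks m (U ω) (Z ω)) P' :=
  aemeasurable_pi_lambda _ <| Fin.cases hU fun i =>
    ((measurable_pi_apply i).comp (measurable_gridIncrement m)).comp_aemeasurable hZ

theorem integral_torusChar_pathBlocks (hU : HasLaw U (vonMises 0) P') (hUZ : IndepFun U Z P')
    (hB : IsPreBrownianReal B P) (hZ : IdentDistrib Z (wrappedPath B c) P' P) {m : ℕ}
    (k : Fin (m + 1) → ℤ) :
    ∫ ω, torusChar k (pathBlocks m (U ω) (Z ω)) ∂P'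
      = ((vonMisesCoeff 0 (k 0)
        * ∏ i : Fin m, Real.exp (-(k i.succ ^ 2 * (1 / m) / (2 * c ^ 2))) : ℝ) : ℂ) := by
  have hmeas_start := (continuous_coe_zpow (k 0)).measurable
  have hmeas_incr : Measurable fun z => torusChar (fun i => k i.succ) (gridIncrement m z) :=
    (torusChar _).continuous.measurable.comp (measurable_gridIncrement m)
  have hsplit : ∀ ω, torusChar k (pathBlocks m (U ω) (Z ω))
      = ((U ω ^ k 0 : Circle) : ℂ) * torusChar (fun i => k i.succ) (gridIncrement m (Z ω)) :=
    fun ω => by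
      simp only [torusChar_apply_eq_prod, Fin.prod_univ_succ, pathBlocks, Fin.cons_zero,
        Fin.cons_succ]
  have hmul := (hUZ.comp hmeas_start hmeas_incr).integral_fun_mul_eq_mul_integral
    (hmeas_start.comp_aemeasurable hU.aemeasurable).aestronglyMeasurable
    (hmeas_incr.comp_aemeasurable hZ.aemeasurable_fst).aestronglyMeasurable
  have hstart := hU.integral_comp hmeas_start.aestronglyMeasurable
  have hincr := (hZ.comp hmeas_incr).integral_eq
  simp only [Function.comp_def] at hmul hstart hincr
  simp only [hsplit, hmul, hstart, hincr, integral_zpow_vonMises,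
    integral_torusChar_gridIncrement_wrappedPath hB, Complex.ofReal_mul]

variable [IsProbabilityMeasure P']

theorem tendstoInDistribution_blocks (hb : 0 < b)
    (hβ : Tendsto (fun n : ℕ => β n / (n : ℝ)) atTop (𝓝 b)) (hU : HasLaw U (vonMises 0) P')
    (hUZ : IndepFun U Z P') (hB : IsPreBrownianReal B P)
    (hZ : IdentDistrib Z (wrappedPath B √b) P' P) {m : ℕ} (hm : 0 < m) :
    TendstoInDistribution (fun n ξ i => ∏ r ∈ blocks n m i, ξ r) atTop
      (fun ω => pathBlocks m (U ω) (Z ω)) (fun n => steps (β n)) P' := by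
  refine tendstoInDistribution_of_tendsto_integral_torusChar (fun n => by fun_prop)
    (aemeasurable_pathBlocks hU.aemeasurable hZ.aemeasurable_fst m) fun k => ?_
  simp only [integral_torusChar_blocks, integral_torusChar_pathBlocks hU hUZ hB hZ,
    Real.sq_sqrt hb.le]
  exact (Complex.continuous_ofReal.tendsto _).comp <| Tendsto.const_mul _ <|
    tendsto_finsetProd _ fun i _ =>
      tendsto_vonMisesCoeff_pow hb hβ (k i.succ) (tendsto_card_block_div hm i)

theorem tendstoInDistribution_spinPath_coarse (hb : 0 < b)
    (hβ : Tendsto (fun n : ℕ => β n / (n : ℝ)) atTop (𝓝 b)) (hU : HasLaw U (vonMises 0) P')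
    (hUZ : IndepFun U Z P') (hZ_zero : ∀ ω, Z ω 0 = 1) (hB : IsPreBrownianReal B P)
    (hZ : IdentDistrib Z (wrappedPath B √b) P' P) {m : ℕ} (hm : 0 < m) :
    TendstoInDistribution (fun n ξ => spinPath m fun j => walk ξ (n * j / m)) atTop
      (fun ω => spinPath m fun j => U ω * Z ω (gridPoint m j)) (fun n => steps (β n)) P' := by
  have h := (tendstoInDistribution_blocks hb hβ hU hUZ hB hZ hm).continuous_comp
    ((lipschitzWith_spinPath m).continuous.comp (continuous_cumProd (m + 1)))
  simpa only [Function.comp_def, walk_eq_cumProd_blocks, cumProd_pathBlocks, hZ_zero] using h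

theorem tendstoInDistribution_spinPath_gridPoint {S : Ω' → CadlagPath Circle}
    (hU : AEMeasurable U P') (hZ : AEMeasurable Z P') (hS : ∀ᵐ ω ∂P', ∀ t, S ω t = U ω * Z ω t)
    (hS_cont : ∀ᵐ ω ∂P', Continuous (S ω).toFun) :
    TendstoInDistribution (fun m ω => spinPath m fun j => U ω * Z ω (gridPoint m j)) atTop S
      (fun _ => P') P' := by
  have hmeas : ∀ m : ℕ,
      AEMeasurable (fun ω => spinPath m fun j => U ω * Z ω (gridPoint m j)) P' := fun m =>
    (lipschitzWith_spinPath m).continuous.measurable.comp_aemeasurable <|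
      aemeasurable_pi_lambda _ fun j => hU.mul ((measurable_pi_apply _).comp_aemeasurable hZ)
  have hlim : ∀ᵐ ω ∂P',
      Tendsto (fun m => spinPath m fun j => U ω * Z ω (gridPoint m j)) atTop (𝓝 (S ω)) := by
    filter_upwards [hS, hS_cont] with ω hω hcont
    simpa only [hω] using tendsto_spinPath_gridPoint hcont
  exact tendstoInDistribution_of_ae_tendsto hmeas
    (aemeasurable_of_tendsto_metrizable_ae atTop hmeas hlim) hlim

theorem eventually_measureReal_edist_spinPath_lt (hb : 0 < b)
    (hβ : Tendsto (fun n : ℕ => β n / (n : ℝ)) atTop (𝓝 b)) {ε : NNReal} (hε : 0 < ε) {δ : ℝ}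
    (hδ : 0 < δ) : ∀ᶠ m : ℕ in atTop, ∀ᶠ n : ℕ in atTop, (steps (β n)).real
      {ξ | ENNReal.ofNNReal ε < edist (spinPath n fun j => walk ξ j)
        (spinPath m fun j => walk ξ (n * j / m))} < δ := by
  refine (eventually_measureReal_oscillates_lt hb hβ (half_pos (NNReal.coe_pos.2 hε)) hδ).mono
    fun m hm => hm.mono fun n hn => (measureReal_mono (fun ξ hξ => ?_)).trans_lt hn
  by_contra h
  refine absurd (edist_spinPath_walk_le h) (not_le.2 ?_)
  rwa [mul_div_cancel₀ _ two_ne_zero, ENNReal.ofReal_coe_nnreal]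

theorem tendstoInDistribution_spinPath_walk {S : Ω' → CadlagPath Circle} (hb : 0 < b)
    (hβ : Tendsto (fun n : ℕ => β n / (n : ℝ)) atTop (𝓝 b)) (hU : HasLaw U (vonMises 0) P')
    (hUZ : IndepFun U Z P') (hZ_zero : ∀ ω, Z ω 0 = 1) (hB : IsBrownianReal B P)
    (hZ : IdentDistrib Z (wrappedPath B √b) P' P) (hS : ∀ᵐ ω ∂P', ∀ t, S ω t = U ω * Z ω t) :
    TendstoInDistribution (fun n ξ => spinPath n fun j => walk ξ j) atTop S
      (fun n => steps (β n)) P' := by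
  have hS_cont := CadlagPath.ae_continuous_of_ae_eq_mul hS hZ (ae_continuous_wrappedPath hB √b)
  have hmeas : ∀ n, Measurable fun ξ : ℕ → Circle => spinPath n fun j => walk ξ j := fun n =>
    (lipschitzWith_spinPath n).continuous.measurable.comp
      (measurable_pi_lambda _ fun j => measurable_walk j)
  exact tendstoInDistribution_of_approx (fun n => (hmeas n).aemeasurable)
    ((eventually_gt_atTop 0).mono fun m hm =>
      tendstoInDistribution_spinPath_coarse hb hβ hU hUZ hZ_zero hB.toIsPreBrownianReal hZ hm)
    (tendstoInDistribution_spinPath_gridPoint hU.aemeasurable hZ.aemeasurable_fst hS hS_cont)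
    fun ε hε δ hδ => eventually_measureReal_edist_spinPath_lt hb hβ hε hδ

theorem tendstoInDistribution_gibbs_of_walk {E : Type*} [TopologicalSpace E] [MeasurableSpace E]
    [OpensMeasurableSpace E] {X : ∀ n, (Fin (n + 1) → Circle) → E} (hX : ∀ n, Measurable (X n))
    {S : Ω' → E} (h : TendstoInDistribution (fun n ξ => X n fun j => walk ξ j) atTop S
      (fun n => steps (β n)) P') :
    TendstoInDistribution X atTop S (fun n => gibbs n (β n)) P' := by
  have hwalk : ∀ n, Measurable fun (ξ : ℕ → Circle) (j : Fin (n + 1)) => walk ξ j := fun n =>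
    measurable_pi_lambda _ fun j => measurable_walk j
  have := fun n => Measure.isProbabilityMeasure_map (μ := steps (β n)) (hwalk n).aemeasurable
  simp only [gibbs_eq_map_walk]
  exact tendstoInDistribution_map (fun n => (hwalk n).aemeasurable) hX h

end Limit

end XYChain

end

open XYChain

theorem mainTheorem8 (β : ℕ → ℝ) (b : ℝ) (hb : 0 < b)
    (hβ : Tendsto (fun n : ℕ => β n / (n : ℝ)) atTop (𝓝 b))
    -- a standard one-dimensional Brownian motion
    {Ω : Type*} [MeasurableSpace Ω] (P : Measure Ω) [IsProbabilityMeasure P]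
    (B : NNReal → Ω → ℝ) (hB : IsBrownianReal B P)
    -- the limiting angle process `Φ` and the càdlàg spin process `S = e^{iΦ}`
    {Ω' : Type*} [MeasurableSpace Ω'] (P' : Measure Ω') [IsProbabilityMeasure P']
    (Φ : I → Ω' → ℝ) (S : Ω' → CadlagPath Circle)
    (hS : ∀ᵐ ω ∂P', ∀ t : I, S ω t = Circle.exp (Φ t ω))
    (hΦ_zero : pdf.IsUniform (Φ 0) (Ico (-Real.pi) Real.pi) P' volume)
    (hΦ_indep : IndepFun (Φ 0) (fun ω (t : I) => Circle.exp (Φ t ω - Φ 0 ω)) P')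
    (hΦ_law : IdentDistrib (fun ω (t : I) => Circle.exp (Φ t ω - Φ 0 ω))
      (fun ω (t : I) => Circle.exp (B (unitInterval.toNNReal t) ω / √b)) P' P) :
    TendstoInDistribution (fun n : ℕ => XYChain.spinPath n) atTop S
      (fun n : ℕ => XYChain.gibbs n (β n)) P' := by
  have hS_mul : ∀ᵐ ω ∂P', ∀ t, S ω t = Circle.exp (Φ 0 ω) * Circle.exp (Φ t ω - Φ 0 ω) :=
    hS.mono fun ω hω t => by rw [hω, ← Circle.exp_add, add_sub_cancel]
  have hindep : IndepFun (fun ω => Circle.exp (Φ 0 ω))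
      (fun ω (t : I) => Circle.exp (Φ t ω - Φ 0 ω)) P' :=
    hΦ_indep.comp Circle.exp.continuous.measurable measurable_id
  have hwalk := tendstoInDistribution_spinPath_walk hb hβ (hasLaw_exp_of_isUniform hΦ_zero) hindep
    (fun ω => by rw [sub_self, Circle.exp_zero]) hB hΦ_law hS_mul
  exact tendstoInDistribution_gibbs_of_walk
    (fun n => (lipschitzWith_spinPath n).continuous.measurable) hwalk
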